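/- Let $(\Omega,\omega)$ be a measure space (for instance a subset $\Omega\subseteq\mathbb R^d$ with a positive measure), let $F:\Omega\to\Omega$ be measurable and $\omega$-preserving, and let $\mathcal K g=g\circ F$ be the Koopman operator, an isometry of $L^2(\Omega,\omega)$ (complex scalars, inner product linear in the first argument) that need not be unitary. **Spectral measure.** Let $\mathcal K'$ be a unitary extension of $\mathcal K$ to a Hilbert space $\mathcal H'\supseteq L^2(\Omega,\omega)$, let $\mathcal E'$ be its projection-valued spectral measure on the unit circle $\mathbb T$, and let $\mathcal P$ be the orthogonal projection of $\mathcal H'$ onto $L^2(\Omega,\omega)$. For $\|g\|=1$ put $\mu_g(U)=\langle \mathcal P\mathcal E'(U)\mathcal P^*g,g\rangle$, a Borel probability measure on $\mathbb T$ that does not depend on the choice of the extension. **Algorithm (mpEDMD).** For every $N$ let $\psi_1,\dots,\psi_N:\Omega\to\mathbb C$ be square-integrable functions that are linearly independent in $L^2(\Omega,\omega)$ (they may depend on $N$). Let $V_N$ be their span, and write $\Psi\mathbf c=\sum_j c_j\psi_j$ for $\mathbf c\in\mathbb C^N$. For all $N,M$ let $x^{(1)},\dots,x^{(M)}\in\Omega$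 be nodes and $w_1,\dots,w_M\in\mathbb R$ weights (both may depend on $N$ and $M$), and put $$G_{jk}=\sum_{m=1}^M w_m\overline{\psi_j(x^{(m)})}\psi_k(x^{(m)}),\qquad A_{jk}=\sum_{m=1}^M w_m\overline{\psi_j(x^{(m)})}\psi_k(F(x^{(m)})).$$ When $G$ is positive definite, take any singular value decomposition $G^{-1/2}A^*G^{-1/2}=U_1\Sigma U_2^*$ and any eigendecomposition $U_2U_1^*=\hat V\Lambda\hat V^*$ with $\hat V$ unitary and $\Lambda=\mathrm{diag}(\lambda_1,\dots,\lambda_N)$, and let $v_1,\dots,v_N$ be the columns of $G^{-1/2}\hat V$. For $\mathbf c\in\mathbb C^N$, $\mathbf c\ne0$, let $\tilde{\mathbf c}=\mathbf c/(\mathbf c^*G\mathbf c)^{1/2}$ and define the probability measure $$\mu_{\mathbf c}^{(N,M)}=\sum_{j=1}^N|v_j^*G\tilde{\mathbf c}|^2\,\delta_{\lambda_j}\quad\text{on }\mathbb T .$$ **Corollary.** Suppose that $\lim_{N\to\infty}\mathrm{dist}(h,V_N)=0$ for all $h\in L^2(\Omega,\omega)$, and that the quadrature converges, i.e. for every $N$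 and all $1\le j,k\le N$ $$\lim_{M\to\infty}G_{jk}=\langle\psi_k,\psi_j\rangle,\qquad \lim_{M\to\infty}A_{jk}=\langle\mathcal K\psi_k,\psi_j\rangle .$$ (By linear independence, $G$ is then positive definite for each $N$ and all $M$ large enough, so that only such $M$ enter below.) Then for every $g\in L^2(\Omega,\omega)$ with $\|g\|=1$, all $\mathbf g_N\in\mathbb C^N$ with $\lim_{N\to\infty}\|g-\Psi\mathbf g_N\|=0$, and all choices of the decompositions above, $$\lim_{N\to\infty}\limsup_{M\to\infty}W_1\bigl(\mu_g,\mu_{\mathbf g_N}^{(N,M)}\bigr)=0,$$ where $W_1(\mu,\nu)=\sup\{\int\phi\,d\mu-\int\phi\,d\nu\}$ over all $\phi:\mathbb T\to\mathbb R$ with $|\phi(z)-\phi(z')|\le|z-z'|$ for all $z,z'$. -/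

import Mathlib

open MeasureTheory Filter Topology
open scoped ENNReal Matrix MatrixOrder

noncomputable section

namespace MpEDMD

universe u v

/-- A projection-valued measure on a measurable space `X`, acting on the Hilbert space `H`: every
measurable set is sent to an orthogonal projection, the whole space to the identity, and the
assignment is countably additive in the strong operator topology. Values on non-measurable sets
carry no meaning and are never used. -/
structure ProjectionValuedMeasure (X : Type v) [MeasurableSpace X] (H : Type u)
    [NormedAddCommGroup H] [InnerProductSpace ℂ H] [CompleteSpace H] where
  proj : Set X → H →L[ℂ] H
  isStarProjection : ∀ S, MeasurableSet S → IsStarProjection (proj S)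
  empty : proj ∅ = 0
  univ : proj Set.univ = 1
  hasSum_iUnion : ∀ S : ℕ → Set X, (∀ i, MeasurableSet (S i)) →
    Pairwise (fun i j => Disjoint (S i) (S j)) →
    ∀ h, HasSum (fun i => proj (S i) h) (proj (⋃ i, S i) h)

section PVM

variable {X : Type v} [MeasurableSpace X] {H : Type u}
  [NormedAddCommGroup H] [InnerProductSpace ℂ H] [CompleteSpace H]

theorem ProjectionValuedMeasure.re_inner_nonneg (E : ProjectionValuedMeasure X H) {S : Set X}
    (hS : MeasurableSet S) (h : H) : 0 ≤ (inner ℂ h (E.proj S h)).re := by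
  have hp := E.isStarProjection S hS
  have h1 : E.proj S (E.proj S h) = E.proj S h := by
    have := hp.isIdempotentElem
    exact congrArg (fun T : H →L[ℂ] H => T h) this
  have h2 : inner ℂ h (E.proj S h) = inner ℂ (E.proj S h) (E.proj S h) := by
    have hs : ContinuousLinearMap.adjoint (E.proj S) = E.proj S := hp.isSelfAdjoint
    conv_lhs => rw [← h1]
    rw [← ContinuousLinearMap.adjoint_inner_left, hs]
  rw [h2]
  exact inner_self_nonneg (𝕜 := ℂ)

/-- The scalar measure `S ↦ ⟨E(S)h, h⟩` of a projection-valued measure at a vector `h`. -/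
def ProjectionValuedMeasure.scalarMeasure (E : ProjectionValuedMeasure X H) (h : H) :
    Measure X :=
  Measure.ofMeasurable (fun S _ => ENNReal.ofReal (inner ℂ h (E.proj S h)).re)
    (by simp [E.empty])
    (by
      intro S hS hd
      have h1 := E.hasSum_iUnion S hS hd h
      have h2 : HasSum (fun i => (inner ℂ h (E.proj (S i) h)).re)
          (inner ℂ h (E.proj (⋃ i, S i) h)).re :=
        Complex.hasSum_re (h1.mapL (innerSL ℂ h))
      rw [← h2.tsum_eq, ENNReal.ofReal_tsum_of_nonneg
        (fun i => E.re_inner_nonneg (hS i) h) h2.summable])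

theorem ProjectionValuedMeasure.scalarMeasure_apply (E : ProjectionValuedMeasure X H) (h : H)
    {S : Set X} (hS : MeasurableSet S) :
    E.scalarMeasure h S = ENNReal.ofReal (inner ℂ h (E.proj S h)).re :=
  Measure.ofMeasurable_apply S hS

end PVM

/-- The unit circle carries its Borel σ-algebra. -/
instance : MeasurableSpace Circle := borel Circle

instance : BorelSpace Circle := ⟨rfl⟩

/-- `E` is the spectral measure of the unitary operator `U`, that is `U = ∫_𝕋 λ dE(λ)`. The
operator identity is expressed by its quadratic form, which determines it by polarization. -/
def IsSpectralMeasureOfUnitary {H : Type u} [NormedAddCommGroup H] [InnerProductSpace ℂ H]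
    [CompleteSpace H] (E : ProjectionValuedMeasure Circle H) (U : H ≃ₗᵢ[ℂ] H) : Prop :=
  ∀ h : H, inner ℂ h (U h) = ∫ z : Circle, (z : ℂ) ∂(E.scalarMeasure h)

/-- A unitary extension `U` of the isometry `K` on a Hilbert space that contains `H` (through the
isometric embedding `embed`), together with the spectral measure of `U`. -/
structure UnitaryExtension {H : Type u} [NormedAddCommGroup H] [InnerProductSpace ℂ H]
    [CompleteSpace H] (K : H →ₗᵢ[ℂ] H) where
  space : Type u
  [normedAddCommGroup : NormedAddCommGroup space]
  [innerProductSpace : InnerProductSpace ℂ space]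
  [completeSpace : CompleteSpace space]
  embed : H →ₗᵢ[ℂ] space
  op : space ≃ₗᵢ[ℂ] space
  op_embed : ∀ h, op (embed h) = embed (K h)
  pvm : ProjectionValuedMeasure Circle space
  isSpectral : IsSpectralMeasureOfUnitary pvm op

attribute [instance] UnitaryExtension.normedAddCommGroup UnitaryExtension.innerProductSpace
  UnitaryExtension.completeSpace

section Isometry

variable {H : Type u} [NormedAddCommGroup H] [InnerProductSpace ℂ H] [CompleteSpace H]

/-- The compression `S ↦ P E'(S) P*` to `H` of the spectral measure `E'` of a unitary extension;
here `P* = embed` and `P` is its adjoint, the orthogonal projection onto `H`. -/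
def UnitaryExtension.compression {K : H →ₗᵢ[ℂ] H} (X : UnitaryExtension K) (S : Set Circle) :
    H →L[ℂ] H :=
  (ContinuousLinearMap.adjoint X.embed.toContinuousLinearMap).comp
    ((X.pvm.proj S).comp X.embed.toContinuousLinearMap)

/-- The measure `S ↦ ⟨E(S)g, g⟩`, where `E(S) = P E'(S) P*`. -/
def UnitaryExtension.vectorMeasure {K : H →ₗᵢ[ℂ] H} (X : UnitaryExtension K) (g : H) :
    Measure Circle :=
  X.pvm.scalarMeasure (X.embed g)

theorem UnitaryExtension.vectorMeasure_apply {K : H →ₗᵢ[ℂ] H} (X : UnitaryExtension K) (g : H)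
    {S : Set Circle} (hS : MeasurableSet S) :
    X.vectorMeasure g S = ENNReal.ofReal (inner ℂ g (X.compression S g)).re := by
  rw [vectorMeasure, ProjectionValuedMeasure.scalarMeasure_apply _ _ hS, compression]
  simp [ContinuousLinearMap.adjoint_inner_right]

open Classical in
/-- The spectral measure `μ_g` of the isometry `K` with respect to the vector `g`, obtained from
some unitary extension of `K` (the measure does not depend on which). Unitary extensions always
exist; the value `0` is a placeholder for the case that never occurs. -/
def spectralMeasure (K : H →ₗᵢ[ℂ] H) (g : H) : Measure Circle :=
  if h : Nonempty (UnitaryExtension K) then h.some.vectorMeasure g else 0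

end Isometry

/-- The Wasserstein-1 distance of two measures on the unit circle, through Lipschitz test
functions. Exchanging `φ` and `-φ` shows that only non-negative differences matter for the
supremum. It takes values in `[0, ∞]`, so that measures of different mass are at distance `∞`. -/
def W1 (μ ν : Measure Circle) : ℝ≥0∞ :=
  ⨆ φ : {φ : Circle → ℝ // LipschitzWith 1 φ},
    ENNReal.ofReal ((∫ z, φ.1 z ∂μ) - ∫ z, φ.1 z ∂ν)

section Data

variable {Ω : Type u} {N M : ℕ}

/-- The matrix with rows `Ψ(x^(m)) = [ψ_1(x^(m)) ⋯ ψ_N(x^(m))]`. -/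
def dataMatrix (ψ : Fin N → Ω → ℂ) (x : Fin M → Ω) : Matrix (Fin M) (Fin N) ℂ :=
  Matrix.of fun m j => ψ j (x m)

/-- `Ψ_X^* W Ψ_Y` with `W = diag(w_1, …, w_M)`. -/
def weightedProduct (ψ : Fin N → Ω → ℂ) (w : Fin M → ℝ) (x y : Fin M → Ω) :
    Matrix (Fin N) (Fin N) ℂ :=
  (dataMatrix ψ x)ᴴ * Matrix.diagonal (fun m => (w m : ℂ)) * dataMatrix ψ y

/-- The Gram matrix `G = Ψ_X^* W Ψ_X`. -/
def gramMatrix (ψ : Fin N → Ω → ℂ) (w : Fin M → ℝ) (x : Fin M → Ω) :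
    Matrix (Fin N) (Fin N) ℂ :=
  weightedProduct ψ w x x

/-- The matrix `A = Ψ_X^* W Ψ_Y`, where `y^(m) = F(x^(m))`. -/
def shiftMatrix (F : Ω → Ω) (ψ : Fin N → Ω → ℂ) (w : Fin M → ℝ) (x : Fin M → Ω) :
    Matrix (Fin N) (Fin N) ℂ :=
  weightedProduct ψ w x (fun m => F (x m))

end Data

section Algorithm

variable {N : ℕ}

/-- The square root `G^{1/2}` of a positive semidefinite matrix. -/
def matSqrt (G : Matrix (Fin N) (Fin N) ℂ) : Matrix (Fin N) (Fin N) ℂ := CFC.sqrt G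

/-- The possible outcomes of a run of mpEDMD on the matrices `G` and `A`: a singular value
decomposition `G^{-1/2} A^* G^{-1/2} = U₁ Σ U₂^*` and a unitary eigendecomposition
`U₂ U₁^* = V̂ Λ V̂^*`. Neither is unique. As `U₂ U₁^*` is unitary, its eigenvalues lie on the unit
circle. -/
structure Run (G A : Matrix (Fin N) (Fin N) ℂ) where
  U₁ : Matrix (Fin N) (Fin N) ℂ
  U₂ : Matrix (Fin N) (Fin N) ℂ
  sing : Fin N → ℝ
  Vhat : Matrix (Fin N) (Fin N) ℂ
  eig : Fin N → Circle
  U₁_mem : U₁ ∈ Matrix.unitaryGroup (Fin N) ℂ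
  U₂_mem : U₂ ∈ Matrix.unitaryGroup (Fin N) ℂ
  sing_nonneg : ∀ j, 0 ≤ sing j
  svd : (matSqrt G)⁻¹ * Aᴴ * (matSqrt G)⁻¹ =
    U₁ * Matrix.diagonal (fun j => (sing j : ℂ)) * U₂ᴴ
  Vhat_mem : Vhat ∈ Matrix.unitaryGroup (Fin N) ℂ
  eigendecomposition :
    U₂ * U₁ᴴ = Vhat * Matrix.diagonal (fun j => (eig j : ℂ)) * Vhatᴴ

variable {G A : Matrix (Fin N) (Fin N) ℂ}

/-- The matrix `V = G^{-1/2} V̂`, whose columns `v_j` are the eigenvectors, with eigenvalues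
`λ_j = eig j`, of the Koopman matrix `G^{-1/2} U₂ U₁^* G^{1/2}`. -/
def Run.V (r : Run G A) : Matrix (Fin N) (Fin N) ℂ := (matSqrt G)⁻¹ * r.Vhat

/-- The vector `c / (c^* G c)^{1/2}`, which is `c` normalized so that `c^* G c = 1`. -/
def normalize (G : Matrix (Fin N) (Fin N) ℂ) (c : Fin N → ℂ) : Fin N → ℂ :=
  (((Real.sqrt (star c ⬝ᵥ G *ᵥ c).re)⁻¹ : ℝ) : ℂ) • c

/-- The measure `∑_j |v_j^* G c|² δ_{λ_j}`, for a vector `c` normalized by `c^* G c = 1`. -/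
def Run.rawMeasure (r : Run G A) (c : Fin N → ℂ) : Measure Circle :=
  ∑ j, ENNReal.ofReal (‖star (fun i => r.V i j) ⬝ᵥ G *ᵥ c‖ ^ 2) • Measure.dirac (r.eig j)

/-- The approximate spectral measure `μ_c^{(N,M)}`, where `c` is first normalized so that
`c^* G c = 1`. -/
def Run.spectralMeasure (r : Run G A) (c : Fin N → ℂ) : Measure Circle :=
  r.rawMeasure (normalize G c)

end Algorithm

section Koopman

variable {Ω : Type u} [MeasurableSpace Ω] {ω : Measure Ω}

/-- The Koopman operator `g ↦ g ∘ F` on `L²(Ω, ω)`. -/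
def koopman (F : Ω → Ω) (hF : MeasurePreserving F ω ω) : Lp ℂ 2 ω →ₗᵢ[ℂ] Lp ℂ 2 ω :=
  Lp.compMeasurePreservingₗᵢ ℂ F hF

/-- The function `Ψ c = ∑_j c_j ψ_j`. -/
def synthesis {N : ℕ} (ψ : Fin N → Lp ℂ 2 ω) (c : Fin N → ℂ) : Lp ℂ 2 ω := ∑ j, c j • ψ j

end Koopman

end MpEDMD

end

/-! On the compact circle, convergence of the moments `∫ z ^ n` with `n ≥ 0` forces convergence in
`W1`: negative moments are conjugates, trigonometric polynomials are dense, and the normalized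
Lipschitz test functions form a compact set. So it suffices to match moments.

Those of `μ_g` are `⟨g, K^n g⟩`, whichever unitary extension is chosen
(`UnitaryExtension.integral_pow_vectorMeasure`). As `spectralMeasure` is `0` by default, an
extension must also be shown to exist; this needs a unitary dilation and the spectral theorem for
it. The moments of the mpEDMD measure are `⟨a, B^n a⟩`, where `a = G^{1/2} c` for the normalized `c`
and `B = U₂ U₁^*` is a unitary polar factor of `C = G^{-1/2} A G^{-1/2}`.

The core is that `B` converges strongly to `K`. Put `J = Ψ G^{-1/2}`. In the limit `J` is isometric
and `C` is the compression `J^* K J`, so `J a → f` implies `J C a → K f`. As `K` preserves norms,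
`‖C a‖` and `‖a‖` have the same limit `‖f‖`. But `C` is almost a contraction, and for a contraction
`‖B a - C a‖² ≤ ‖a‖² - ‖C a‖²`; hence `B a - C a → 0` and `J B a → K f`
(`IsAsymptoticPolarCompression.tendsto_polar`). Iteration gives `J B^n a → K^n f`. Only forward
powers occur, so `K` need not be unitary.

The limit in `M` followed by the limit in `N` is a single limit along the filter `atTop.curry
atTop`. -/

noncomputable section

namespace MpEDMD

/-! ### Moments and Wasserstein convergence on the circle -/

section WeakConvergence

theorem Circle.integrable_of_continuous {E : Type*} [NormedAddCommGroup E] {f : Circle → E}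
    (hf : Continuous f) (μ : Measure Circle) [IsFiniteMeasure μ] [SecondCountableTopology E] :
    Integrable f μ := by
  borelize E
  exact hf.integrable_of_hasCompactSupport (HasCompactSupport.of_compactSpace f)

/-- The monomial `z ↦ z ^ k` on the circle. -/
def circleMonomial (k : ℤ) : C(Circle, ℂ) :=
  ⟨fun z => ((z ^ k : Circle) : ℂ), continuous_induced_dom.comp (continuous_zpow k)⟩

theorem circleMonomial_neg (k : ℤ) (z : Circle) :
    circleMonomial (-k) z = starRingEnd ℂ (circleMonomial k z) := by
  simp only [circleMonomial, ContinuousMap.coe_mk, zpow_neg, Circle.coe_inv_eq_conj]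

/-- Stone–Weierstrass for the star algebra generated by `z`. Since `star z = z⁻¹` on the circle, the
monomials are closed under product and star, so their linear span already contains this algebra. -/
theorem closure_span_circleMonomial :
    (Submodule.span ℂ (Set.range circleMonomial)).topologicalClosure = ⊤ := by
  set A : StarSubalgebra ℂ C(Circle, ℂ) := StarAlgebra.adjoin ℂ {circleMonomial 1} with hA
  have hsep : A.SeparatesPoints := by
    intro x y hxy
    refine ⟨circleMonomial 1, ⟨circleMonomial 1, ?_, rfl⟩, ?_⟩
    · exact StarAlgebra.subset_adjoin ℂ _ rfl
    · simpa [circleMonomial, Circle.coe_inj] using hxy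
  have htop := ContinuousMap.starSubalgebra_topologicalClosure_eq_top_of_separatesPoints A hsep
  have hspan : Subalgebra.toSubmodule A.toSubalgebra ≤
      Submodule.span ℂ (Set.range circleMonomial) := by
    rw [hA, StarAlgebra.adjoin_eq_span, Submodule.span_le]
    intro f hf
    apply Submodule.subset_span
    induction hf using Submonoid.closure_induction with
    | mem f hf =>
      rcases hf with hf | hf
      · exact ⟨1, hf.symm⟩
      · refine ⟨-1, ?_⟩
        have hf' : star f = circleMonomial 1 := hf
        rw [← star_star f, hf']
        ext z
        exact circleMonomial_neg 1 z
    | one => exact ⟨0, by ext z; simp [circleMonomial]⟩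
    | mul f g _ _ hf hg =>
      obtain ⟨m, rfl⟩ := hf
      obtain ⟨n, rfl⟩ := hg
      exact ⟨m + n, by ext z; simp [circleMonomial, zpow_add]⟩
  rw [eq_top_iff]
  intro f _
  have hf : f ∈ A.topologicalClosure := by rw [htop]; trivial
  exact closure_mono hspan hf

variable {ι : Type*} {l : Filter ι} {μ : Measure Circle} [IsProbabilityMeasure μ]
  {ν : ι → Measure Circle}

theorem norm_integral_sub_integral_le {E : Type*} [NormedAddCommGroup E] [NormedSpace ℝ E]
    [SecondCountableTopology E] {f p : Circle → E} (hf : Continuous f) (hp : Continuous p) {ε : ℝ}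
    (h : ∀ z, ‖f z - p z‖ ≤ ε) (ρ : Measure Circle) [IsProbabilityMeasure ρ] :
    ‖(∫ z, f z ∂ρ) - ∫ z, p z ∂ρ‖ ≤ ε := by
  rw [← integral_sub (Circle.integrable_of_continuous hf ρ) (Circle.integrable_of_continuous hp ρ)]
  simpa using norm_integral_le_of_norm_le_const (μ := ρ) (ae_of_all _ h)

/-- Positive measures have conjugate moments at `k` and `-k`, so non-negative exponents suffice. The
unit masses make uniform approximation by trigonometric polynomials uniform in `i`. -/
theorem tendsto_integral_of_tendsto_moments (hν : ∀ᶠ i in l, IsProbabilityMeasure (ν i))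
    (hm : ∀ n : ℕ, Tendsto (fun i => ∫ z, (z : ℂ) ^ n ∂ν i) l (𝓝 (∫ z, (z : ℂ) ^ n ∂μ)))
    (f : C(Circle, ℂ)) :
    Tendsto (fun i => ∫ z, f z ∂ν i) l (𝓝 (∫ z, f z ∂μ)) := by
  have hmono : ∀ k : ℤ, Tendsto (fun i => ∫ z, circleMonomial k z ∂ν i) l
      (𝓝 (∫ z, circleMonomial k z ∂μ)) := by
    have hnat : ∀ n : ℕ, Tendsto (fun i => ∫ z, circleMonomial n z ∂ν i) l
      (𝓝 (∫ z, circleMonomial n z ∂μ)) := fun n => by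
        simpa [circleMonomial] using hm n
    intro k
    obtain ⟨n, rfl | rfl⟩ := k.eq_nat_or_neg
    · exact hnat n
    · simp only [circleMonomial_neg, integral_conj]
      exact (Complex.continuous_conj.tendsto _).comp (hnat n)
  have hspan : ∀ p ∈ Submodule.span ℂ (Set.range circleMonomial),
      Tendsto (fun i => ∫ z, p z ∂ν i) l (𝓝 (∫ z, p z ∂μ)) := by
    intro p hp
    induction hp using Submodule.span_induction with
    | mem p hp => obtain ⟨k, rfl⟩ := hp; exact hmono k
    | zero => simpa using tendsto_const_nhds
    | add p q _ _ hp hq =>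
      have key : ∀ (ρ : Measure Circle) [IsProbabilityMeasure ρ],
          ∫ z, (p + q) z ∂ρ = (∫ z, p z ∂ρ) + ∫ z, q z ∂ρ := fun ρ _ =>
        integral_add (Circle.integrable_of_continuous p.continuous ρ)
          (Circle.integrable_of_continuous q.continuous ρ)
      rw [key μ]
      refine (hp.add hq).congr' ?_
      filter_upwards [hν] with i hi
      exact (key (ν i)).symm
    | smul a p _ hp =>
      simp only [ContinuousMap.smul_apply, integral_smul]
      exact hp.const_smul a
  rw [Metric.tendsto_nhds]
  intro ε hε
  have hf : f ∈ (Submodule.span ℂ (Set.range circleMonomial)).topologicalClosure := by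
    rw [closure_span_circleMonomial]; trivial
  obtain ⟨p, hp, hfp⟩ := Metric.mem_closure_iff.1 hf (ε / 4) (by positivity)
  have hfp' : ∀ z, ‖f z - p z‖ ≤ ε / 4 := fun z => by
    rw [← dist_eq_norm]
    exact (ContinuousMap.dist_apply_le_dist z).trans hfp.le
  filter_upwards [hν, Metric.tendsto_nhds.1 (hspan p hp) (ε / 4) (by positivity)] with i hi hi'
  have h1 := norm_integral_sub_integral_le f.continuous p.continuous hfp' (ν i)
  have h2 := norm_integral_sub_integral_le f.continuous p.continuous hfp' μ
  rw [← dist_eq_norm] at h1 h2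
  rw [dist_comm] at h2
  have h3 := dist_triangle4 (∫ z, f z ∂ν i) (∫ z, p z ∂ν i) (∫ z, p z ∂μ) (∫ z, f z ∂μ)
  linarith

/-- The normalized `1`-Lipschitz functions on the circle. -/
def normalizedLipschitz : Set (BoundedContinuousFunction Circle ℝ) :=
  {φ | LipschitzWith 1 φ ∧ φ 1 = 0}

/-- Arzelà–Ascoli: the normalization at `1` and the diameter `2` of the circle confine all values to
`[-2, 2]`. -/
theorem isCompact_normalizedLipschitz : IsCompact normalizedLipschitz := by
  refine BoundedContinuousFunction.arzela_ascoli₂ (Set.Icc (-2) 2) isCompact_Icc _ ?_ ?_ ?_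
  · have : normalizedLipschitz =
        (⋂ x, ⋂ y, {φ : BoundedContinuousFunction Circle ℝ | dist (φ x) (φ y) ≤ dist x y}) ∩
          {φ | φ 1 = 0} := by
      ext φ
      simp [normalizedLipschitz, lipschitzWith_iff_dist_le_mul]
    rw [this]
    refine IsClosed.inter (isClosed_iInter fun x => isClosed_iInter fun y => ?_) ?_
    · exact isClosed_le ((continuous_eval_const _).dist
        (continuous_eval_const _)) continuous_const
    · exact isClosed_eq (continuous_eval_const _) continuous_const
  · rintro φ x ⟨hφ, h1⟩
    have h := hφ.dist_le_mul x 1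
    have h2 : dist x 1 ≤ 2 := by
      have : dist x 1 = ‖(x : ℂ) - 1‖ := by
        exact dist_eq_norm (x : ℂ) 1
      rw [this]
      refine (norm_sub_le _ _).trans ?_
      rw [Circle.norm_coe, norm_one]; norm_num
    rw [h1, Real.dist_eq, sub_zero] at h
    rw [NNReal.coe_one, one_mul] at h
    exact abs_le.1 (h.trans h2)
  · refine LipschitzWith.uniformEquicontinuous (fun φ : normalizedLipschitz => (φ : Circle → ℝ)) 1
      (fun φ => φ.2.1) |>.equicontinuous

/-- Convergence of the moments of probability measures on the circle implies convergence in the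
Wasserstein distance. -/
theorem tendsto_W1_of_tendsto_moments (hν : ∀ᶠ i in l, IsProbabilityMeasure (ν i))
    (hm : ∀ n : ℕ, Tendsto (fun i => ∫ z, (z : ℂ) ^ n ∂ν i) l (𝓝 (∫ z, (z : ℂ) ^ n ∂μ))) :
    Tendsto (fun i => W1 μ (ν i)) l (𝓝 0) := by
  have hreal : ∀ φ : BoundedContinuousFunction Circle ℝ,
      Tendsto (fun i => ∫ z, φ z ∂ν i) l (𝓝 (∫ z, φ z ∂μ)) := by
    intro φ
    have h := tendsto_integral_of_tendsto_moments hν hm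
      ⟨fun z => ((φ z : ℝ) : ℂ), Complex.continuous_ofReal.comp φ.continuous⟩
    simp only [ContinuousMap.coe_mk, integral_complex_ofReal] at h
    exact (Complex.continuous_re.tendsto _).comp h
  rw [ENNReal.tendsto_nhds_zero]
  intro ε hε
  obtain ⟨δ, hδ0, hδ⟩ : ∃ δ : ℝ, 0 < δ ∧ ENNReal.ofReal δ ≤ ε := by
    rcases eq_or_ne ε ⊤ with rfl | h
    · exact ⟨1, one_pos, le_top⟩
    · exact ⟨ε.toReal, ENNReal.toReal_pos hε.ne' h, ENNReal.ofReal_toReal_le⟩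
  -- A finite net turns convergence for each test function into uniform convergence; the three
  -- errors of `δ / 3` are the two replacements by a net point and the convergence there.
  obtain ⟨t, -, ht, hcov⟩ := isCompact_normalizedLipschitz.finite_cover_balls
    (e := δ / 3) (by positivity)
  have hfin : ∀ᶠ i in l, ∀ φ ∈ t, dist (∫ z, φ z ∂ν i) (∫ z, φ z ∂μ) < δ / 3 :=
    (ht.eventually_all).2 fun φ _ => Metric.tendsto_nhds.1 (hreal φ) _ (by positivity)
  filter_upwards [hν, hfin] with i hi hclose
  refine le_trans (iSup_le ?_) hδ
  rintro ⟨φ, hφ⟩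
  apply ENNReal.ofReal_le_ofReal
  -- Both measures have mass one, so subtracting the constant `φ 1` does not change the difference
  -- of integrals.
  set φ₀ : BoundedContinuousFunction Circle ℝ :=
    BoundedContinuousFunction.mkOfCompact ⟨fun z => φ z - φ 1, hφ.continuous.sub continuous_const⟩
    with hφ₀
  have hmem : φ₀ ∈ normalizedLipschitz := by
    refine ⟨?_, by simp [hφ₀]⟩
    rw [lipschitzWith_iff_dist_le_mul] at hφ ⊢
    intro x y
    simpa [hφ₀] using hφ x y
  obtain ⟨p, hp, hφp⟩ := Set.mem_iUnion₂.1 (hcov hmem)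
  have hint : ∀ (ρ : Measure Circle) [IsProbabilityMeasure ρ],
      ∫ z, φ z ∂ρ = (∫ z, φ₀ z ∂ρ) + φ 1 := by
    intro ρ _
    have : ∫ z, φ₀ z ∂ρ = (∫ z, φ z ∂ρ) - φ 1 := by
      simp [hφ₀, integral_sub (Circle.integrable_of_continuous hφ.continuous ρ)
        (integrable_const _)]
    rw [this]; ring
  have hle : ∀ z, ‖φ₀ z - p z‖ ≤ δ / 3 := fun z => by
    rw [← dist_eq_norm]
    exact (BoundedContinuousFunction.dist_coe_le_dist z).trans (Metric.mem_ball.1 hφp).le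
  have h1 := norm_integral_sub_integral_le φ₀.continuous p.continuous hle (ν i)
  have h2 := norm_integral_sub_integral_le φ₀.continuous p.continuous hle μ
  have h3 := hclose p hp
  rw [Real.norm_eq_abs, abs_le] at h1 h2
  rw [Real.dist_eq, abs_lt] at h3
  change (∫ z, φ z ∂μ) - ∫ z, φ z ∂ν i ≤ δ
  rw [hint μ, hint (ν i)]
  linarith [h1.1, h1.2, h2.1, h2.2, h3.1, h3.2]

end WeakConvergence

end MpEDMD

namespace MpEDMD

universe u v

/-! ### Moments of spectral measures of unitary operators -/

section SpectralMoments

variable {X : Type v} [MeasurableSpace X] {H : Type u}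
  [NormedAddCommGroup H] [InnerProductSpace ℂ H] [CompleteSpace H]

namespace ProjectionValuedMeasure

variable (E : ProjectionValuedMeasure X H)

theorem proj_proj {S : Set X} (hS : MeasurableSet S) (h : H) :
    E.proj S (E.proj S h) = E.proj S h :=
  congrArg (fun T : H →L[ℂ] H => T h) (E.isStarProjection S hS).isIdempotentElem

theorem inner_proj_left {S : Set X} (hS : MeasurableSet S) (h k : H) :
    inner ℂ (E.proj S h) k = inner ℂ h (E.proj S k) := by
  have hs : ContinuousLinearMap.adjoint (E.proj S) = E.proj S :=
    (E.isStarProjection S hS).isSelfAdjoint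
  conv_lhs => rw [← hs]
  exact ContinuousLinearMap.adjoint_inner_left _ _ _

theorem inner_proj_self {S : Set X} (hS : MeasurableSet S) (h : H) :
    inner ℂ h (E.proj S h) = ((E.scalarMeasure h).real S : ℂ) := by
  have h2 : inner ℂ h (E.proj S h) = inner ℂ (E.proj S h) (E.proj S h) := by
    rw [E.inner_proj_left hS, E.proj_proj hS]
  rw [Measure.real, E.scalarMeasure_apply h hS, ENNReal.toReal_ofReal (E.re_inner_nonneg hS h), h2]
  rw [inner_self_eq_norm_sq_to_K]
  norm_cast

/-- Additivity is postulated for sequences only, so finite partitions are sequences that are empty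
outside `t`. -/
theorem sum_proj {S : ℕ → Set X} (hS : ∀ i, MeasurableSet (S i))
    (hd : Pairwise fun i j => Disjoint (S i) (S j)) {t : Finset ℕ} (ht : ∀ i ∉ t, S i = ∅) :
    ∑ i ∈ t, E.proj (S i) = E.proj (⋃ i, S i) := by
  ext h
  have h1 := E.hasSum_iUnion S hS hd h
  have h2 : HasSum (fun i => E.proj (S i) h) (∑ i ∈ t, E.proj (S i) h) :=
    hasSum_sum_of_ne_finset_zero fun i hi => by simp [ht i hi, E.empty]
  rw [h1.unique h2]
  simp

theorem proj_union {S T : Set X} (hS : MeasurableSet S) (hT : MeasurableSet T)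
    (hd : Disjoint S T) : E.proj (S ∪ T) = E.proj S + E.proj T := by
  let f : ℕ → Set X := fun i => if i = 0 then S else if i = 1 then T else ∅
  have h := E.sum_proj (S := f) (t := {0, 1}) (fun i => by
      by_cases h0 : i = 0
      · simpa [f, h0]
      · by_cases h1 : i = 1 <;> simp [f, h0, h1, hT]) (fun i j hij => by
      by_cases h0 : i = 0
      · by_cases h1 : j = 1
        · simpa [f, h0, h1] using hd
        · simp [f, h0, h1, show j ≠ 0 by omega]
      · by_cases h1 : i = 1
        · by_cases h2 : j = 0
          · simpa [f, h1, h2] using hd.symm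
          · simp [f, h1, h2, show j ≠ 1 by omega]
        · simp [f, h0, h1]) (fun i hi => by
      simp only [Finset.mem_insert, Finset.mem_singleton, not_or] at hi
      simp [f, hi.1, hi.2])
  have hU : ⋃ i, f i = S ∪ T := by
    ext x
    simp only [Set.mem_iUnion, Set.mem_union]
    constructor
    · rintro ⟨i, hi⟩
      by_cases h0 : i = 0
      · left; simpa [f, h0] using hi
      · by_cases h1 : i = 1
        · right; simpa [f, h1] using hi
        · simp [f, h0, h1] at hi
    · rintro (hx | hx)
      · exact ⟨0, by simpa [f] using hx⟩
      · exact ⟨1, by simpa [f] using hx⟩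
  rw [hU] at h
  rw [← h]
  simp [f]

/-- The sum `P + Q` is again idempotent, so `PQ + QP = 0`; multiplying by `P` on both sides in turn
shows that `P` and `Q` commute, whence `2PQ = 0`. -/
theorem proj_mul_proj_of_disjoint {S T : Set X} (hS : MeasurableSet S) (hT : MeasurableSet T)
    (hd : Disjoint S T) : E.proj S * E.proj T = 0 := by
  have hP := (E.isStarProjection S hS).isIdempotentElem
  have hQ := (E.isStarProjection T hT).isIdempotentElem
  have hPQ := (E.isStarProjection _ (hS.union hT)).isIdempotentElem
  rw [E.proj_union hS hT hd] at hPQ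
  set P := E.proj S
  set Q := E.proj T
  unfold IsIdempotentElem at *
  have h1 : P * Q + Q * P = 0 := by
    have : (P + Q) * (P + Q) = P * P + Q * Q + (P * Q + Q * P) := by noncomm_ring
    rw [this, hP, hQ] at hPQ
    simpa using hPQ
  have h2 : P * Q = -(Q * P) := eq_neg_of_add_eq_zero_left h1
  have h3 : P * Q = Q * P := by
    calc P * Q = P * (P * Q) := by rw [← mul_assoc, hP]
      _ = -((P * Q) * P) := by conv_lhs => rw [h2, mul_neg, ← mul_assoc]
      _ = (Q * P) * P := by rw [h2, neg_mul, neg_neg]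
      _ = Q * P := by rw [mul_assoc, hP]
  rw [← h3] at h1
  have h4 : (2 : ℂ) • (P * Q) = 0 := by rw [two_smul]; exact h1
  simpa using h4

theorem scalarMeasure_univ (h : H) : E.scalarMeasure h Set.univ = ENNReal.ofReal (‖h‖ ^ 2) := by
  rw [E.scalarMeasure_apply h MeasurableSet.univ, E.univ]
  simp [← Complex.ofReal_pow]

instance (h : H) : IsFiniteMeasure (E.scalarMeasure h) :=
  ⟨by rw [scalarMeasure_univ]; exact ENNReal.ofReal_lt_top⟩

variable {E} in
theorem pow_sum_smul_proj {S : ℕ → Set X} (hS : ∀ i, MeasurableSet (S i))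
    (hd : Pairwise fun i j => Disjoint (S i) (S j)) {t : Finset ℕ} (ht : ∀ i ∉ t, S i = ∅)
    (hU : ⋃ i, S i = Set.univ) (a : ℕ → ℂ) (k : ℕ) :
    (∑ i ∈ t, a i • E.proj (S i)) ^ k = ∑ i ∈ t, a i ^ k • E.proj (S i) := by
  induction k with
  | zero => simp [E.sum_proj hS hd ht, hU, E.univ]
  | succ k ih =>
    rw [pow_succ, ih, Finset.sum_mul_sum]
    refine Finset.sum_congr rfl fun i hi => ?_
    rw [Finset.sum_eq_single i]
    · rw [smul_mul_smul_comm, (E.isStarProjection _ (hS i)).isIdempotentElem.eq, pow_succ]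
    · intro j _ hj
      rw [smul_mul_smul_comm, E.proj_mul_proj_of_disjoint (hS i) (hS j) (hd hj.symm), smul_zero]
    · exact fun h => absurd hi h

variable {E} in
theorem norm_integral_sub_sum_le {S : ℕ → Set X} (hS : ∀ i, MeasurableSet (S i))
    (hd : Pairwise fun i j => Disjoint (S i) (S j)) {t : Finset ℕ} (ht : ∀ i ∉ t, S i = ∅)
    (hU : ⋃ i, S i = Set.univ) (a : ℕ → ℂ) {f : X → ℂ} {h : H}
    (hf : Integrable f (E.scalarMeasure h)) {δ : ℝ} (hfa : ∀ i, ∀ z ∈ S i, ‖f z - a i‖ ≤ δ) :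
    ‖(∫ z, f z ∂(E.scalarMeasure h)) - inner ℂ h ((∑ i ∈ t, a i • E.proj (S i)) h)‖
      ≤ δ * ‖h‖ ^ 2 := by
  set μ := E.scalarMeasure h
  have hU' : ⋃ i ∈ t, S i = Set.univ := by
    rw [← hU]
    refine subset_antisymm (Set.iUnion₂_subset fun i _ => Set.subset_iUnion S i)
      (Set.iUnion_subset fun i => ?_)
    by_cases hi : i ∈ t
    · exact Set.subset_biUnion_of_mem (u := S) hi
    · simp [ht i hi]
  have h1 : ∫ z, f z ∂μ = ∑ i ∈ t, ∫ z in S i, f z ∂μ := by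
    rw [← setIntegral_univ, ← hU', integral_biUnion_finset t (fun i _ => hS i)
      (fun i _ j _ hij => hd hij) (fun i _ => hf.integrableOn)]
  have h2 : inner ℂ h ((∑ i ∈ t, a i • E.proj (S i)) h) = ∑ i ∈ t, ∫ z in S i, a i ∂μ := by
    simp only [_root_.sum_apply, inner_sum, _root_.smul_apply,
      inner_smul_right]
    refine Finset.sum_congr rfl fun i _ => ?_
    rw [E.inner_proj_self (hS i), setIntegral_const, mul_comm]
    simp [μ]
  have h3 : ∑ i ∈ t, μ.real (S i) = ‖h‖ ^ 2 := by
    rw [← measureReal_biUnion_finset (fun i _ j _ hij => hd hij) (fun i _ => hS i), hU',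
      Measure.real, E.scalarMeasure_univ, ENNReal.toReal_ofReal (by positivity)]
  rw [h1, h2, ← Finset.sum_sub_distrib, ← h3, Finset.mul_sum]
  refine norm_sum_le_of_le _ fun i _ => ?_
  rw [← integral_sub hf.integrableOn (integrable_const _)]
  exact norm_setIntegral_le_of_norm_le_const (measure_lt_top _ _) (hfa i)

end ProjectionValuedMeasure

theorem exists_finite_partition_circle {ε : ℝ} (hε : 0 < ε) :
    ∃ (S : ℕ → Set Circle) (t : Finset ℕ) (a : ℕ → Circle), (∀ i, MeasurableSet (S i)) ∧
      (Pairwise fun i j => Disjoint (S i) (S j)) ∧ (∀ i ∉ t, S i = ∅) ∧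
      (⋃ i, S i = Set.univ) ∧ ∀ i, ∀ z ∈ S i, ‖(z : ℂ) - a i‖ ≤ ε := by
  classical
  let a := TopologicalSpace.denseSeq Circle
  obtain ⟨t, ht⟩ := isCompact_univ.elim_finite_subcover (fun i => Metric.ball (a i) ε)
    (fun i => Metric.isOpen_ball) (fun z _ => by
      obtain ⟨i, hi⟩ := (TopologicalSpace.denseRange_denseSeq Circle).exists_dist_lt z hε
      exact Set.mem_iUnion.2 ⟨i, hi⟩)
  let B : ℕ → Set Circle := fun i => if i ∈ t then Metric.ball (a i) ε else ∅
  have hB : ∀ i, MeasurableSet (B i) := fun i => by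
    by_cases hi : i ∈ t
    · simp only [B, hi, if_true]; exact Metric.isOpen_ball.measurableSet
    · simp [B, hi]
  refine ⟨disjointed B, t, a, fun i => MeasurableSet.disjointed hB i, disjoint_disjointed B,
    fun i hi => ?_, ?_, fun i z hz => ?_⟩
  · exact Set.subset_empty_iff.1 ((disjointed_subset B i).trans (by simp [B, hi]))
  · rw [iUnion_disjointed]
    refine Set.eq_univ_of_univ_subset (ht.trans ?_)
    refine Set.iUnion₂_subset fun i hi => ?_
    refine Set.subset_iUnion_of_subset i ?_
    simp [B, hi]
  · have h1 := disjointed_subset B i hz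
    by_cases hi : i ∈ t
    · simp only [B, hi, if_true] at h1
      have h2 := (Metric.mem_ball.1 h1).le
      have h3 : dist z (a i) = ‖(z : ℂ) - a i‖ := dist_eq_norm (z : ℂ) (a i : ℂ)
      rwa [h3] at h2
    · simp [B, hi] at h1

theorem norm_circle_pow_sub_pow_le (z w : Circle) (k : ℕ) :
    ‖(z : ℂ) ^ k - (w : ℂ) ^ k‖ ≤ k * ‖(z : ℂ) - w‖ := by
  induction k with
  | zero => simp
  | succ k ih =>
    have : (z : ℂ) ^ (k + 1) - (w : ℂ) ^ (k + 1) =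
        (z : ℂ) ^ k * (z - w) + (z ^ k - w ^ k) * w := by ring
    rw [this]
    refine (norm_add_le _ _).trans ?_
    simp only [norm_mul, norm_pow, Circle.norm_coe, one_pow, one_mul, mul_one]
    push_cast
    linarith

/-- `T` is a Riemann sum of `∫ z dE` over a partition of mesh `ε`. Orthogonality of its projections
makes `T ^ k` the Riemann sum of `z ^ k`, so one `T` serves all powers and all vectors. -/
theorem ProjectionValuedMeasure.exists_approx (E : ProjectionValuedMeasure Circle H) {ε : ℝ}
    (hε : 0 < ε) : ∃ T : H →L[ℂ] H, ∀ (h : H) (k : ℕ),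
      ‖(∫ z, (z : ℂ) ^ k ∂(E.scalarMeasure h)) - inner ℂ h ((T ^ k) h)‖ ≤ k * ε * ‖h‖ ^ 2 := by
  obtain ⟨S, t, a, hS, hd, ht, hU, ha⟩ := exists_finite_partition_circle hε
  refine ⟨∑ i ∈ t, (a i : ℂ) • E.proj (S i), fun h k => ?_⟩
  rw [pow_sum_smul_proj hS hd ht hU]
  refine norm_integral_sub_sum_le hS hd ht hU (fun i => (a i : ℂ) ^ k)
    (Circle.integrable_of_continuous (by fun_prop) _) fun i z hz => ?_
  exact (norm_circle_pow_sub_pow_le z (a i) k).trans (by gcongr; exact ha i z hz)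

omit [CompleteSpace H] in
-- Polarization at `x = D y` and the parallelogram law give `‖x‖² ≤ ε (‖x‖² + ‖y‖²)`; `ε ≤ 1 / 2`
-- absorbs the first term.
theorem norm_sq_apply_le_of_quadratic_form_le (D : H →L[ℂ] H) {ε : ℝ} (hε : ε ≤ 1 / 2)
    (hD : ∀ h, ‖inner ℂ h (D h)‖ ≤ ε * ‖h‖ ^ 2) (y : H) : ‖D y‖ ^ 2 ≤ 2 * ε * ‖y‖ ^ 2 := by
  have hD' : ∀ h, ‖inner ℂ (D h) h‖ ≤ ε * ‖h‖ ^ 2 := fun h => by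
    rw [norm_inner_symm]; exact hD h
  set x := D y
  have hpol := inner_map_polarization (D : H →ₗ[ℂ] H) x y
  simp only [ContinuousLinearMap.coe_coe] at hpol
  have hI : ‖Complex.I • y‖ = ‖y‖ := by simp [norm_smul]
  have h1 := hD' (x + y)
  have h2 := hD' (x - y)
  have h3 := hD' (x + Complex.I • y)
  have h4 := hD' (x - Complex.I • y)
  have p1 := parallelogram_law_with_norm ℂ x y
  have p2 := parallelogram_law_with_norm ℂ x (Complex.I • y)
  rw [hI] at p2
  have hn : ‖inner ℂ (D y) x‖ ≤ (ε * ‖x + y‖ ^ 2 + ε * ‖x - y‖ ^ 2 +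
      ε * ‖x + Complex.I • y‖ ^ 2 + ε * ‖x - Complex.I • y‖ ^ 2) / 4 := by
    rw [hpol, norm_div]
    have : ‖(4 : ℂ)‖ = 4 := by norm_num
    rw [this]
    gcongr
    refine (norm_sub_le _ _).trans (add_le_add ((norm_add_le _ _).trans (add_le_add
      ((norm_sub_le _ _).trans (add_le_add h1 h2)) ?_)) ?_)
    · rw [norm_mul, Complex.norm_I, one_mul]; assumption
    · rw [norm_mul, Complex.norm_I, one_mul]; assumption
  have hself : ‖inner ℂ (D y) x‖ = ‖x‖ ^ 2 := by
    rw [inner_self_eq_norm_sq_to_K]; simp [x]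
  rw [hself] at hn
  nlinarith [sq_nonneg ‖x‖]

/-- The moments of the scalar spectral measures of a unitary operator. -/
theorem IsSpectralMeasureOfUnitary.integral_pow {E : ProjectionValuedMeasure Circle H}
    {U : H ≃ₗᵢ[ℂ] H} (hE : IsSpectralMeasureOfUnitary E U) (h : H) (k : ℕ) :
    ∫ z, (z : ℂ) ^ k ∂(E.scalarMeasure h) = inner ℂ h ((U ^ k) h) := by
  set V : H →L[ℂ] H := (U : H ≃L[ℂ] H).toContinuousLinearMap with hV
  have hε : ∀ m : ℕ, (0 : ℝ) < 1 / (m + 1) := fun m => by positivity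
  choose T hT using fun m : ℕ => E.exists_approx (hε m)
  have hlim : Tendsto (fun m : ℕ => (1 : ℝ) / (m + 1)) atTop (𝓝 0) :=
    tendsto_one_div_add_atTop_nhds_zero_nat
  -- The hypothesis on `E` controls first moments only. The bound for `k = 1` makes the quadratic
  -- form of `T m - V` small, hence its norm, and norm convergence passes to all powers.
  have hTV : Tendsto T atTop (𝓝 V) := by
    rw [tendsto_iff_norm_sub_tendsto_zero]
    have hs : Tendsto (fun m : ℕ => √(2 * ((1 : ℝ) / (m + 1)))) atTop (𝓝 0) := by
      simpa using (hlim.const_mul 2).sqrt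
    refine squeeze_zero' (Eventually.of_forall fun m => norm_nonneg _) ?_ hs
    filter_upwards [hlim.eventually_le_const (show (0 : ℝ) < 1 / 2 by norm_num)] with m hm
    refine ContinuousLinearMap.opNorm_le_bound _ (Real.sqrt_nonneg _) fun y => ?_
    have := norm_sq_apply_le_of_quadratic_form_le (T m - V) hm (fun h => by
      have h1 := hT m h 1
      simp only [pow_one, ← hE h, Nat.cast_one, one_mul] at h1
      rw [_root_.sub_apply, inner_sub_right, norm_sub_rev]
      exact h1) y
    rw [← Real.sqrt_sq (norm_nonneg ((T m - V) y)), ← Real.sqrt_sq (norm_nonneg y),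
      ← Real.sqrt_mul (by positivity)]
    exact Real.sqrt_le_sqrt this
  have hpow : (V ^ k) h = (U ^ k) h := by
    clear_value V
    induction k generalizing h with
    | zero => simp
    | succ k ih =>
      rw [pow_succ, pow_succ]
      have : V h = U h := by rw [hV]; rfl
      simp only [mul_apply_eq_comp, LinearIsometryEquiv.coe_mul, Function.comp, this]
      exact ih (U h)
  have hA : Tendsto (fun m => inner ℂ h ((T m ^ k) h)) atTop (𝓝 (inner ℂ h ((U ^ k) h))) := by
    rw [← hpow]
    exact ((continuous_const.inner (ContinuousLinearMap.apply ℂ H h).continuous).tendsto _).comp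
      (hTV.pow k)
  have hB : Tendsto (fun m => inner ℂ h ((T m ^ k) h)) atTop
      (𝓝 (∫ z, (z : ℂ) ^ k ∂(E.scalarMeasure h))) := by
    rw [tendsto_iff_norm_sub_tendsto_zero]
    have hz : Tendsto (fun m : ℕ => k * ((1 : ℝ) / (m + 1)) * ‖h‖ ^ 2) atTop (𝓝 0) := by
      simpa using (hlim.const_mul (k : ℝ)).mul_const (‖h‖ ^ 2)
    refine squeeze_zero (fun m => norm_nonneg _) (fun m => ?_) hz
    rw [norm_sub_rev]
    exact hT m h k
  exact tendsto_nhds_unique hB hA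

theorem UnitaryExtension.op_pow_embed {K : H →ₗᵢ[ℂ] H} (X : UnitaryExtension K) (k : ℕ) (g : H) :
    (X.op ^ k) (X.embed g) = X.embed (K^[k] g) := by
  induction k generalizing g with
  | zero => simp
  | succ k ih =>
    rw [pow_succ, LinearIsometryEquiv.coe_mul, Function.comp, X.op_embed, ih, Function.iterate_succ,
      Function.comp]

theorem UnitaryExtension.integral_pow_vectorMeasure {K : H →ₗᵢ[ℂ] H} (X : UnitaryExtension K)
    (k : ℕ) (g : H) : ∫ z, (z : ℂ) ^ k ∂(X.vectorMeasure g) = inner ℂ g (K^[k] g) := by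
  rw [vectorMeasure, X.isSpectral.integral_pow, X.op_pow_embed, LinearIsometry.inner_map_map]

theorem UnitaryExtension.isProbabilityMeasure_vectorMeasure {K : H →ₗᵢ[ℂ] H}
    (X : UnitaryExtension K) {g : H} (hg : ‖g‖ = 1) : IsProbabilityMeasure (X.vectorMeasure g) :=
  ⟨by rw [vectorMeasure, ProjectionValuedMeasure.scalarMeasure_univ, X.embed.norm_map, hg]; simp⟩

end SpectralMoments

end MpEDMD

namespace MpEDMD

universe u

/-! ### The spectral theorem for unitary operators -/

section FunctionalCalculus

variable {H : Type u} [NormedAddCommGroup H] [InnerProductSpace ℂ H] [CompleteSpace H]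
  (π : C(Circle, ℂ) →⋆ₐ[ℂ] (H →L[ℂ] H))

/-- The coercion of real-valued continuous functions to complex-valued ones. -/
def ofRealMap (f : C(Circle, ℝ)) : C(Circle, ℂ) := ⟨fun z => (f z : ℂ), by fun_prop⟩

theorem inner_map_star_mul (f g : C(Circle, ℂ)) (h : H) :
    inner ℂ h (π (star f * g) h) = inner ℂ (π f h) (π g h) := by
  rw [map_mul, map_star, mul_apply_eq_comp, ContinuousLinearMap.star_eq_adjoint,
    ContinuousLinearMap.adjoint_inner_right]

theorem re_inner_map_nonneg {f : C(Circle, ℝ)} (hf : ∀ z, 0 ≤ f z) (h : H) :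
    0 ≤ (inner ℂ h (π (ofRealMap f) h)).re := by
  let s : C(Circle, ℂ) := ofRealMap ⟨fun z => √(f z), by fun_prop⟩
  have hs : ofRealMap f = star s * s := by
    ext z
    simp only [ofRealMap, s, ContinuousMap.coe_mk, ContinuousMap.mul_apply,
      ContinuousMap.star_apply, Complex.star_def, Complex.conj_ofReal]
    rw [← Complex.ofReal_mul, Real.mul_self_sqrt (hf z)]
  rw [hs, inner_map_star_mul]
  exact inner_self_nonneg (𝕜 := ℂ)

/-- The positive functional `f ↦ ⟨h, π(f) h⟩` on the real continuous functions. -/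
def vectorFunctional (h : H) : CompactlySupportedContinuousMap Circle ℝ →ₚ[ℝ] ℝ :=
  PositiveLinearMap.mk₀
    { toFun := fun f => (inner ℂ h (π (ofRealMap f.toContinuousMap) h)).re
      map_add' := fun f g => by
        have : ofRealMap (f + g).toContinuousMap =
            ofRealMap f.toContinuousMap + ofRealMap g.toContinuousMap := by
          ext z; simp [ofRealMap]
        rw [this, map_add, add_apply, inner_add_right, Complex.add_re]
      map_smul' := fun a f => by
        have : ofRealMap (a • f).toContinuousMap = (a : ℂ) • ofRealMap f.toContinuousMap := by
          ext z; simp [ofRealMap]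
        rw [this, map_smul, smul_apply, inner_smul_right, Complex.re_ofReal_mul]
        rfl }
    (fun f hf => re_inner_map_nonneg π (f := f.toContinuousMap) (fun z => hf z) h)

/-- The measure representing the functional `f ↦ ⟨h, π(f) h⟩`. -/
def representingMeasure (h : H) : Measure Circle := RealRMK.rieszMeasure (vectorFunctional π h)

instance (h : H) : IsFiniteMeasure (representingMeasure π h) :=
  inferInstanceAs (IsFiniteMeasure (RealRMK.rieszMeasure (vectorFunctional π h)))

theorem integral_representingMeasure_real (h : H) (f : C(Circle, ℝ)) :
    ∫ z, f z ∂(representingMeasure π h) = (inner ℂ h (π (ofRealMap f) h)).re :=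
  RealRMK.integral_rieszMeasure (vectorFunctional π h)
    (CompactlySupportedContinuousMap.continuousMapEquiv f)

/-- `∫ |f|² dμ_h = ⟨h, π(f^* f) h⟩ = ‖π(f) h‖²`. Hence `f ↦ π(f) h` extends isometrically to
`L²(μ_h)`, where indicator functions are available. -/
theorem norm_toLp_representingMeasure (h : H) (f : C(Circle, ℂ)) :
    ‖ContinuousMap.toLp 2 (representingMeasure π h) ℂ f‖ = ‖π f h‖ := by
  rw [← sq_eq_sq₀ (norm_nonneg _) (norm_nonneg _)]
  have h1 : ‖ContinuousMap.toLp 2 (representingMeasure π h) ℂ f‖ ^ 2 =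
      ∫ z, ‖f z‖ ^ 2 ∂(representingMeasure π h) := by
    have h2 := L2.inner_def (𝕜 := ℂ) (ContinuousMap.toLp 2 (representingMeasure π h) ℂ f)
      (ContinuousMap.toLp 2 (representingMeasure π h) ℂ f)
    rw [inner_self_eq_norm_sq_to_K] at h2
    have h3 : ∫ z, inner ℂ (ContinuousMap.toLp 2 (representingMeasure π h) ℂ f z)
        (ContinuousMap.toLp 2 (representingMeasure π h) ℂ f z) ∂(representingMeasure π h) =
        ((∫ z, ‖f z‖ ^ 2 ∂(representingMeasure π h) : ℝ) : ℂ) := by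
      rw [← integral_complex_ofReal]
      refine integral_congr_ae ?_
      filter_upwards [ContinuousMap.coeFn_toLp (p := 2) (𝕜 := ℂ) (representingMeasure π h) f]
        with z hz
      rw [hz, inner_self_eq_norm_sq_to_K]
      simp
    rw [h3] at h2
    apply Complex.ofReal_injective
    rw [← h2]
    simp
  have h4 : ofRealMap ⟨fun z => ‖f z‖ ^ 2, by fun_prop⟩ = star f * f := by
    ext z
    simp [ofRealMap, Complex.conj_mul']
  rw [h1]
  refine (integral_representingMeasure_real π h ⟨fun z => ‖f z‖ ^ 2, by fun_prop⟩).trans ?_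
  rw [h4, inner_map_star_mul, inner_self_eq_norm_sq_to_K]
  norm_cast

theorem denseRange_toLp (h : H) :
    DenseRange (ContinuousMap.toLp (E := ℂ) 2 (representingMeasure π h) ℂ) :=
  ContinuousMap.toLp_denseRange ℂ (representingMeasure π h) ℂ (by norm_num)

/-- The isometry `L²(μ_h) → H` extending `f ↦ π(f) h`. -/
def cyclicMap (h : H) : Lp ℂ 2 (representingMeasure π h) →L[ℂ] H :=
  ((ContinuousLinearMap.apply ℂ H h).toLinearMap ∘ₗ π.toLinearMap).extendOfNorm
    (ContinuousMap.toLp (E := ℂ) 2 (representingMeasure π h) ℂ).toLinearMap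

theorem cyclicMap_toLp (h : H) (f : C(Circle, ℂ)) :
    cyclicMap π h (ContinuousMap.toLp 2 (representingMeasure π h) ℂ f) = π f h :=
  LinearMap.extendOfNorm_eq
    (f := (ContinuousLinearMap.apply ℂ H h).toLinearMap ∘ₗ π.toLinearMap)
    (e := (ContinuousMap.toLp (E := ℂ) 2 (representingMeasure π h) ℂ).toLinearMap)
    (denseRange_toLp π h)
    ⟨1, fun f => by
      rw [one_mul]; exact (norm_toLp_representingMeasure π h f).ge⟩ f

theorem norm_cyclicMap (h : H) (x : Lp ℂ 2 (representingMeasure π h)) :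
    ‖cyclicMap π h x‖ = ‖x‖ := by
  refine (denseRange_toLp π h).induction_on x
    (isClosed_eq (by fun_prop) (by fun_prop)) fun f => ?_
  rw [cyclicMap_toLp, norm_toLp_representingMeasure]

theorem inner_cyclicMap (h : H) (x y : Lp ℂ 2 (representingMeasure π h)) :
    inner ℂ (cyclicMap π h x) (cyclicMap π h y) = inner ℂ x y :=
  LinearIsometry.inner_map_map
    (⟨(cyclicMap π h).toLinearMap, norm_cyclicMap π h⟩ : _ →ₗᵢ[ℂ] H) x y

/-- The class of an indicator function in `L²(μ_h)`. -/
def indicatorL2 (h : H) {S : Set Circle} (hS : MeasurableSet S) :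
    Lp ℂ 2 (representingMeasure π h) :=
  indicatorConstLp 2 hS (measure_ne_top _ _) 1

theorem indicatorL2_univ (h : H) :
    indicatorL2 π h MeasurableSet.univ = ContinuousMap.toLp 2 (representingMeasure π h) ℂ 1 := by
  apply Lp.ext
  refine indicatorConstLp_coeFn.trans (EventuallyEq.trans ?_
    (ContinuousMap.coeFn_toLp (p := 2) (𝕜 := ℂ) (representingMeasure π h) 1).symm)
  exact Eventually.of_forall fun z => by simp

theorem cyclicMap_univ (h : H) : cyclicMap π h (indicatorL2 π h MeasurableSet.univ) = h := by
  rw [indicatorL2_univ, cyclicMap_toLp, map_one, one_apply_eq_self]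

/-- Approximation in `L²` of the sum of the measures `μ_h` yields one `f` for all `h ∈ t`. This is
how linearity in `h` of the indicator's action is inherited from the linear `π f`, although each `h`
has its own `L²(μ_h)`. -/
theorem exists_forall_norm_cyclicMap_sub_le {S : Set Circle} (hS : MeasurableSet S) (t : Finset H)
    {ε : ℝ} (hε : 0 < ε) :
    ∃ f : C(Circle, ℂ), ∀ h ∈ t, ‖cyclicMap π h (indicatorL2 π h hS) - π f h‖ ≤ ε := by
  set μ : Measure Circle := ∑ h ∈ t, representingMeasure π h
  have hmem : MemLp (S.indicator fun _ => (1 : ℂ)) 2 μ :=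
    memLp_indicator_const 2 hS 1 (Or.inr (measure_ne_top _ _))
  obtain ⟨f, hf, -⟩ := hmem.exists_boundedContinuous_eLpNorm_sub_le (by norm_num)
    (ε := ENNReal.ofReal ε) (by simpa using hε)
  refine ⟨f.toContinuousMap, fun h hh => ?_⟩
  have hle : representingMeasure π h ≤ μ :=
    Finset.single_le_sum (f := fun h => representingMeasure π h) (fun _ _ => Measure.zero_le _) hh
  rw [← cyclicMap_toLp, ← map_sub, norm_cyclicMap, Lp.norm_def]
  refine ENNReal.toReal_le_of_le_ofReal hε.le (le_trans ?_ hf)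
  refine le_trans (le_of_eq ?_) (eLpNorm_mono_measure _ hle)
  refine eLpNorm_congr_ae ?_
  filter_upwards [Lp.coeFn_sub (indicatorL2 π h hS)
    (ContinuousMap.toLp 2 (representingMeasure π h) ℂ f.toContinuousMap),
    ContinuousMap.coeFn_toLp (p := 2) (𝕜 := ℂ) (representingMeasure π h) f.toContinuousMap,
    indicatorConstLp_coeFn (p := 2) (hs := hS) (hμs := measure_ne_top (representingMeasure π h) S)
      (c := (1 : ℂ))] with z h1 h2 h3
  rw [h1, Pi.sub_apply, Pi.sub_apply, h2, indicatorL2, h3]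
  rfl

theorem norm_indicatorL2_sq (h : H) {S : Set Circle} (hS : MeasurableSet S) :
    ‖indicatorL2 π h hS‖ ^ 2 = (representingMeasure π h).real S := by
  rw [indicatorL2, norm_indicatorConstLp (by norm_num) (by norm_num), norm_one, one_mul,
    ← Real.rpow_natCast, ← Real.rpow_mul measureReal_nonneg]
  norm_num

theorem norm_cyclicMap_indicatorL2_le (h : H) {S : Set Circle} (hS : MeasurableSet S) :
    ‖cyclicMap π h (indicatorL2 π h hS)‖ ≤ ‖h‖ := by
  have h1 : ‖h‖ = ‖indicatorL2 π h MeasurableSet.univ‖ := by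
    rw [← norm_cyclicMap, cyclicMap_univ]
  rw [norm_cyclicMap, h1, ← sq_le_sq₀ (norm_nonneg _) (norm_nonneg _), norm_indicatorL2_sq,
    norm_indicatorL2_sq]
  exact measureReal_mono (Set.subset_univ _)

theorem inner_cyclicMap_indicatorL2 (h : H) {S : Set Circle} (hS : MeasurableSet S) :
    inner ℂ h (cyclicMap π h (indicatorL2 π h hS)) = ((representingMeasure π h).real S : ℂ) := by
  have h0 : inner ℂ h (cyclicMap π h (indicatorL2 π h hS)) =
      inner ℂ (indicatorL2 π h MeasurableSet.univ) (indicatorL2 π h hS) := by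
    rw [← inner_cyclicMap, cyclicMap_univ]
  rw [h0, indicatorL2, L2.inner_indicatorConstLp_one, setIntegral_univ]
  refine (integral_congr_ae indicatorConstLp_coeFn).trans ?_
  rw [integral_indicator hS]
  simp

/-- The spectral projection of a measurable set, acting on each vector by the indicator function
in the cyclic subspace that the vector generates. -/
def spectralProjection {S : Set Circle} (hS : MeasurableSet S) : H →L[ℂ] H :=
  LinearMap.mkContinuous
    { toFun := fun h => cyclicMap π h (indicatorL2 π h hS)
      map_add' := fun h k => by
        classical
        rw [← sub_eq_zero, ← norm_le_zero_iff]
        refine le_of_forall_pos_le_add fun ε hε => ?_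
        obtain ⟨f, hf⟩ := exists_forall_norm_cyclicMap_sub_le π hS {h, k, h + k}
          (show (0 : ℝ) < ε / 3 by positivity)
        have h1 := hf h (by simp)
        have h2 := hf k (by simp)
        have h3 := hf (h + k) (by simp)
        set a := cyclicMap π h (indicatorL2 π h hS)
        set b := cyclicMap π k (indicatorL2 π k hS)
        set c := cyclicMap π (h + k) (indicatorL2 π (h + k) hS)
        have : c - (a + b) = (c - π f (h + k)) - (a - π f h) - (b - π f k) := by
          rw [map_add]; abel
        rw [this]
        have h4 := norm_sub_le ((c - π f (h + k)) - (a - π f h)) (b - π f k)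
        have h5 := norm_sub_le (c - π f (h + k)) (a - π f h)
        linarith
      map_smul' := fun r h => by
        classical
        rw [← sub_eq_zero, ← norm_le_zero_iff]
        refine le_of_forall_pos_le_add fun ε hε => ?_
        have hr : 0 < 1 + ‖r‖ := by positivity
        obtain ⟨f, hf⟩ := exists_forall_norm_cyclicMap_sub_le π hS {h, r • h}
          (show (0 : ℝ) < ε / (1 + ‖r‖) by positivity)
        have h1 := hf h (by simp)
        have h2 := hf (r • h) (by simp)
        set a := cyclicMap π h (indicatorL2 π h hS)
        set c := cyclicMap π (r • h) (indicatorL2 π (r • h) hS)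
        have : c - r • a = (c - π f (r • h)) - r • (a - π f h) := by
          rw [map_smul, smul_sub]; abel
        rw [RingHom.id_apply, this]
        have h5 := norm_sub_le (c - π f (r • h)) (r • (a - π f h))
        rw [norm_smul] at h5
        have h6 : ‖r‖ * ‖a - π f h‖ ≤ ‖r‖ * (ε / (1 + ‖r‖)) := by gcongr
        have h7 : ε / (1 + ‖r‖) + ‖r‖ * (ε / (1 + ‖r‖)) = ε := by field_simp
        linarith } 1
    (fun h => (norm_cyclicMap_indicatorL2_le π h hS).trans_eq (one_mul _).symm)

theorem spectralProjection_apply {S : Set Circle} (hS : MeasurableSet S) (h : H) :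
    spectralProjection π hS h = cyclicMap π h (indicatorL2 π h hS) := rfl

/-- Both `⟨h, P h⟩` and `‖P h‖²` equal `μ_h(S)`, so `P^* P = P` by polarization; this one identity
gives self-adjointness and then idempotence. -/
theorem isStarProjection_spectralProjection {S : Set Circle} (hS : MeasurableSet S) :
    IsStarProjection (spectralProjection π hS) := by
  set P := spectralProjection π hS with hP
  have h1 : ContinuousLinearMap.adjoint P * P = P := by
    have : ((ContinuousLinearMap.adjoint P * P : H →L[ℂ] H) : H →ₗ[ℂ] H) = P := by
      rw [← ext_inner_map]
      intro h
      simp only [ContinuousLinearMap.coe_coe, mul_apply_eq_comp]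
      rw [ContinuousLinearMap.adjoint_inner_left, ← inner_conj_symm (P h) h, hP,
        spectralProjection_apply, inner_cyclicMap_indicatorL2, inner_cyclicMap,
        inner_self_eq_norm_sq_to_K, Complex.conj_ofReal, ← norm_indicatorL2_sq π h hS]
      norm_cast
    exact ContinuousLinearMap.coe_injective this
  have h2 : IsSelfAdjoint P := by
    rw [← h1]
    exact IsSelfAdjoint.star_mul_self P
  refine ⟨?_, h2⟩
  have h3 : ContinuousLinearMap.adjoint P = P := h2
  rw [h3] at h1
  exact h1

theorem sum_indicatorL2 (h : H) {S : ℕ → Set Circle} (hS : ∀ i, MeasurableSet (S i))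
    (hd : Pairwise fun i j => Disjoint (S i) (S j)) (s : Finset ℕ) :
    ∑ i ∈ s, indicatorL2 π h (hS i) =
      indicatorL2 π h (Finset.measurableSet_biUnion s fun i _ => hS i) := by
  classical
  induction s using Finset.induction_on with
  | empty =>
    apply Lp.ext
    refine (Lp.coeFn_zero ℂ 2 _).trans ?_
    refine EventuallyEq.trans ?_ indicatorConstLp_coeFn.symm
    exact Eventually.of_forall fun z => by simp
  | insert a s ha ih =>
    rw [Finset.sum_insert ha, ih]
    have hdis : Disjoint (S a) (⋃ i ∈ s, S i) := by
      simp only [Set.disjoint_iUnion_right]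
      exact fun i hi => hd (fun h => ha (h ▸ hi))
    have := indicatorConstLp_disjoint_union (p := 2) (hS a)
      (Finset.measurableSet_biUnion s fun i _ => hS i)
      (measure_ne_top (representingMeasure π h) _) (measure_ne_top (representingMeasure π h) _)
      hdis (1 : ℂ)
    refine this.symm.trans ?_
    simp only [indicatorL2, Finset.set_biUnion_insert]

theorem hasSum_indicatorL2 (h : H) {S : ℕ → Set Circle} (hS : ∀ i, MeasurableSet (S i))
    (hd : Pairwise fun i j => Disjoint (S i) (S j)) :
    HasSum (fun i => indicatorL2 π h (hS i)) (indicatorL2 π h (MeasurableSet.iUnion hS)) := by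
  unfold HasSum
  simp only [sum_indicatorL2 π h hS hd]
  refine tendsto_indicatorConstLp_set (by norm_num) ?_
  set μ := representingMeasure π h
  have hsub : ∀ s : Finset ℕ, (⋃ i ∈ s, S i) ⊆ ⋃ i, S i := fun s =>
    Set.iUnion₂_subset fun i _ => Set.subset_iUnion S i
  have hlim : Tendsto (fun s : Finset ℕ => μ (⋃ i ∈ s, S i)) atTop (𝓝 (μ (⋃ i, S i))) := by
    rw [measure_iUnion hd hS]
    have : ∀ s : Finset ℕ, μ (⋃ i ∈ s, S i) = ∑ i ∈ s, μ (S i) := fun s =>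
      measure_biUnion_finset (fun i _ j _ hij => hd hij) fun i _ => hS i
    simp only [this]
    exact ENNReal.summable.hasSum
  have h2 : ∀ s : Finset ℕ, μ (symmDiff (⋃ i ∈ s, S i) (⋃ i, S i)) =
      μ (⋃ i, S i) - μ (⋃ i ∈ s, S i) := fun s => by
    rw [symmDiff_of_le (hsub s)]
    exact measure_sdiff (hsub s) (Finset.measurableSet_biUnion s fun i _ => hS i).nullMeasurableSet
      (measure_ne_top _ _)
  simp only [h2]
  have := ENNReal.Tendsto.sub (tendsto_const_nhds (x := μ (⋃ i, S i))) hlim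
    (Or.inl (measure_ne_top _ _))
  simpa using this

open Classical in
/-- The projection-valued measure of a representation of the continuous functions on the
circle. -/
def representationPVM : ProjectionValuedMeasure Circle H where
  proj S := if hS : MeasurableSet S then spectralProjection π hS else 0
  isStarProjection S hS := by
    rw [dif_pos hS]; exact isStarProjection_spectralProjection π hS
  empty := by
    ext h
    rw [dif_pos MeasurableSet.empty, spectralProjection_apply]
    have : indicatorL2 π h MeasurableSet.empty = 0 := indicatorConstLp_empty
    rw [this, map_zero, zero_apply]
  univ := by
    ext h
    rw [dif_pos MeasurableSet.univ, spectralProjection_apply, cyclicMap_univ, one_apply_eq_self]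
  hasSum_iUnion S hS hd h := by
    simp only [dif_pos (hS _), dif_pos (MeasurableSet.iUnion hS), spectralProjection_apply]
    exact (hasSum_indicatorL2 π h hS hd).mapL (cyclicMap π h)

theorem representationPVM_scalarMeasure (h : H) :
    (representationPVM π).scalarMeasure h = representingMeasure π h := by
  ext S hS
  rw [ProjectionValuedMeasure.scalarMeasure_apply _ _ hS]
  simp only [representationPVM, dif_pos hS, spectralProjection_apply, inner_cyclicMap_indicatorL2]
  simp

theorem integral_representingMeasure (h : H) (f : C(Circle, ℂ)) :
    ∫ z, f z ∂(representingMeasure π h) = inner ℂ h (π f h) := by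
  have h1 : inner ℂ h (π f h) = inner ℂ (indicatorL2 π h MeasurableSet.univ)
      (ContinuousMap.toLp 2 (representingMeasure π h) ℂ f) := by
    rw [← inner_cyclicMap, cyclicMap_univ, cyclicMap_toLp]
  rw [h1, indicatorL2, L2.inner_indicatorConstLp_one, setIntegral_univ]
  exact integral_congr_ae
    (ContinuousMap.coeFn_toLp (p := 2) (𝕜 := ℂ) (representingMeasure π h) f).symm

/-- The continuous functional calculus of a unitary operator, on the whole circle. -/
def unitaryCalculus (U : H ≃ₗᵢ[ℂ] H) : C(Circle, ℂ) →⋆ₐ[ℂ] (H →L[ℂ] H) :=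
  let V := Unitary.linearIsometryEquiv.symm U
  (cfcHom (R := ℂ) (a := (V : H →L[ℂ] H)) (isStarNormal_of_mem_unitary V.2)).comp
    -- Restriction of functions to the spectrum, which lies in the circle, moves the calculus to
    -- `C(Circle, ℂ)`.
    (ContinuousMap.compStarAlgHom' ℂ ℂ
      ⟨fun z => (⟨z, spectrum.subset_circle_of_unitary V.2 z.2⟩ : Circle),
        Continuous.subtype_mk continuous_subtype_val _⟩)

theorem unitaryCalculus_coe (U : H ≃ₗᵢ[ℂ] H) (h : H) :
    unitaryCalculus U ⟨fun z => (z : ℂ), by fun_prop⟩ h = U h := by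
  set V := Unitary.linearIsometryEquiv.symm U with hV
  have h1 := cfcHom_id (R := ℂ) (a := (V : H →L[ℂ] H)) (isStarNormal_of_mem_unitary V.2)
  have h2 : unitaryCalculus U ⟨fun z => (z : ℂ), by fun_prop⟩ = (V : H →L[ℂ] H) := h1
  rw [h2, hV, Unitary.coe_symm_linearIsometryEquiv_apply]
  rfl

/-- The spectral theorem for a unitary operator. -/
theorem exists_isSpectralMeasureOfUnitary (U : H ≃ₗᵢ[ℂ] H) :
    ∃ E : ProjectionValuedMeasure Circle H, IsSpectralMeasureOfUnitary E U := by
  refine ⟨representationPVM (unitaryCalculus U), fun h => ?_⟩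
  rw [representationPVM_scalarMeasure, ← unitaryCalculus_coe U h,
    ← integral_representingMeasure (unitaryCalculus U) h]
  rfl

end FunctionalCalculus

end MpEDMD

namespace MpEDMD

universe u

/-! ### Existence of unitary extensions of an isometry -/

section UnitaryDilation

variable {H : Type u} [NormedAddCommGroup H] [InnerProductSpace ℂ H]

section Shift

variable (D : Type u) [NormedAddCommGroup D] [InnerProductSpace ℂ D]

/-- The backward shift on `ℓ²(ℕ, D)`. -/
def backwardShift : lp (fun _ : ℕ => D) 2 →ₗ[ℂ] lp (fun _ : ℕ => D) 2 where
  toFun x := ⟨fun n => x (n + 1), by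
    have h : Summable fun n => ‖x n‖ ^ (2 : ℝ≥0∞).toReal := (lp.memℓp x).summable (by norm_num)
    exact memℓp_gen ((summable_nat_add_iff 1).2 h)⟩
  map_add' _ _ := rfl
  map_smul' _ _ := rfl

/-- The sequence `x` preceded by `d`. -/
def consSeq (d : D) (x : lp (fun _ : ℕ => D) 2) : lp (fun _ : ℕ => D) 2 :=
  ⟨fun n => Nat.casesOn n d fun n => x n, by
    have h : Summable fun n => ‖x n‖ ^ (2 : ℝ≥0∞).toReal := (lp.memℓp x).summable (by norm_num)
    exact memℓp_gen ((summable_nat_add_iff 1).1 h)⟩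

variable {D}

theorem lp_norm_sq_eq (x : lp (fun _ : ℕ => D) 2) :
    ‖x‖ ^ 2 = ‖x 0‖ ^ 2 + ‖backwardShift D x‖ ^ 2 := by
  have h : ∀ y : lp (fun _ : ℕ => D) 2, HasSum (fun n => ‖y n‖ ^ 2) (‖y‖ ^ 2) := fun y => by
    simpa using lp.hasSum_norm (p := 2) (by norm_num) y
  have h1 := (h x).tsum_eq
  rw [(h x).summable.tsum_eq_zero_add] at h1
  rw [← h1, ← (h (backwardShift D x)).tsum_eq]
  rfl

end Shift

variable [CompleteSpace H] (K : H →ₗᵢ[ℂ] H)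

/-- The orthogonal complement of the range of an isometry. -/
abbrev defectSpace : Submodule ℂ H := (LinearMap.range K.toLinearMap)ᗮ

/-- The Hilbert space of the unitary dilation of an isometry. -/
abbrev dilationSpace : Type u := WithLp 2 (H × lp (fun _ : ℕ => defectSpace K) 2)

/-- The unitary dilation `(h, x₀, x₁, …) ↦ (K h + x₀, x₁, x₂, …)` as a linear isometry. -/
def dilationIsometry : dilationSpace K →ₗᵢ[ℂ] dilationSpace K where
  toFun v := WithLp.toLp 2 (K v.fst + (v.snd 0 : H), backwardShift _ v.snd)
  map_add' v w := by
    apply WithLp.ofLp_injective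
    ext1
    · simp only [WithLp.add_fst, WithLp.add_snd, map_add, WithLp.ofLp_add, Prod.fst_add,
        lp.coeFn_add, Pi.add_apply, Submodule.coe_add]
      abel
    · simp [map_add]
  map_smul' a v := by
    apply WithLp.ofLp_injective
    ext1
    · simp
    · simp [map_smul]
  norm_map' v := by
    rw [← sq_eq_sq₀ (norm_nonneg _) (norm_nonneg _), WithLp.prod_norm_sq_eq_of_L2,
      WithLp.prod_norm_sq_eq_of_L2, lp_norm_sq_eq v.snd]
    have horth : inner ℂ (K v.fst) (v.snd 0 : H) = 0 :=
      Submodule.inner_right_of_mem_orthogonal (LinearMap.mem_range_self K.toLinearMap v.fst)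
        (v.snd 0).2
    have h := norm_add_sq_eq_norm_sq_add_norm_sq_of_inner_eq_zero _ _ horth
    rw [K.norm_map] at h
    change ‖K v.fst + (v.snd 0 : H)‖ ^ 2 + ‖backwardShift _ v.snd‖ ^ 2 =
      ‖v.fst‖ ^ 2 + (‖(v.snd 0 : H)‖ ^ 2 + ‖backwardShift _ v.snd‖ ^ 2)
    linarith

/-- The range of an isometry is closed, so `H` is its sum with the defect space. The defect
component of `w.fst` is put in front of the sequence `w.snd`. -/
theorem dilationIsometry_surjective : Function.Surjective (dilationIsometry K) := by
  intro w
  have hcl : IsClosed (LinearMap.range K.toLinearMap : Set H) := by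
    exact K.isometry.isClosedEmbedding.isClosed_range
  have : CompleteSpace (LinearMap.range K.toLinearMap) := hcl.completeSpace_coe
  obtain ⟨y, hy, z, hz, hyz⟩ :=
    (LinearMap.range K.toLinearMap).exists_add_mem_mem_orthogonal w.fst
  obtain ⟨h, rfl⟩ := hy
  refine ⟨WithLp.toLp 2 (h, consSeq _ ⟨z, hz⟩ w.snd), ?_⟩
  apply WithLp.ofLp_injective
  ext1
  · exact hyz.symm
  · rfl

theorem nonempty_unitaryExtension : Nonempty (UnitaryExtension K) := by
  let U : dilationSpace K ≃ₗᵢ[ℂ] dilationSpace K :=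
    LinearIsometryEquiv.ofSurjective (dilationIsometry K) (dilationIsometry_surjective K)
  obtain ⟨E, hE⟩ := exists_isSpectralMeasureOfUnitary U
  exact ⟨{
    space := dilationSpace K
    embed :=
      { toFun := fun h => WithLp.toLp 2 (h, 0)
        map_add' := fun h k => by
          apply WithLp.ofLp_injective
          simp
        map_smul' := fun a h => by
          apply WithLp.ofLp_injective
          simp
        norm_map' := fun h => by
          rw [← sq_eq_sq₀ (norm_nonneg _) (norm_nonneg _)]
          simp }
    op := U
    op_embed := fun h => by
      apply WithLp.ofLp_injective
      change (K h + ((0 : lp (fun _ : ℕ => defectSpace K) 2) 0 : H),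
        backwardShift _ (0 : lp (fun _ : ℕ => defectSpace K) 2)) = (K h, 0)
      simp
    pvm := E
    isSpectral := hE }⟩

theorem isProbabilityMeasure_spectralMeasure {g : H} (hg : ‖g‖ = 1) :
    IsProbabilityMeasure (spectralMeasure K g) := by
  rw [spectralMeasure, dif_pos (nonempty_unitaryExtension K)]
  exact UnitaryExtension.isProbabilityMeasure_vectorMeasure _ hg

theorem integral_pow_spectralMeasure (k : ℕ) (g : H) :
    ∫ z, (z : ℂ) ^ k ∂(spectralMeasure K g) = inner ℂ g (K^[k] g) := by
  rw [spectralMeasure, dif_pos (nonempty_unitaryExtension K)]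
  exact UnitaryExtension.integral_pow_vectorMeasure _ k g

end UnitaryDilation

end MpEDMD

namespace MpEDMD

/-! ### Strong convergence of compressions and polar factors -/

section AsymptoticCompression

variable {ι : Type*} {l : Filter ι} {E : ι → Type*} [∀ i, NormedAddCommGroup (E i)]
  [∀ i, InnerProductSpace ℂ (E i)] {H : Type*} [NormedAddCommGroup H] [InnerProductSpace ℂ H]

/-- Along the filter `l`, the maps `J i : E i → H` are asymptotically isometric with asymptotically
dense range, `C i` is asymptotically the compression of the isometry `K` to `E i`, and `B i` is a
polar factor of `C i`. -/
structure IsAsymptoticPolarCompression (l : Filter ι) (J : ∀ i, E i →ₗ[ℂ] H) (K : H →ₗᵢ[ℂ] H)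
    (C B : ∀ i, E i → E i) (δ : ι → ℝ) : Prop where
  nonneg : ∀ i, 0 ≤ δ i
  tendsto_zero : Tendsto δ l (𝓝 0)
  inner_left : ∀ᶠ i in l, ∀ a b, ‖inner ℂ (J i a) (J i b) - inner ℂ a b‖ ≤ δ i * ‖a‖ * ‖b‖
  inner_right : ∀ᶠ i in l, ∀ a b,
    ‖inner ℂ (J i a) (K (J i b)) - inner ℂ a (C i b)‖ ≤ δ i * ‖a‖ * ‖b‖
  exists_tendsto : ∀ f, ∃ q : ∀ i, E i, Tendsto (fun i => J i (q i)) l (𝓝 f)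
  polar : ∀ᶠ i in l, ∀ η, 0 ≤ η → (∀ a, ‖C i a‖ ^ 2 ≤ (1 + η) * ‖a‖ ^ 2) →
    ∀ a, ‖B i a - C i a‖ ^ 2 ≤ (1 + 2 * η) * ‖a‖ ^ 2 - ‖C i a‖ ^ 2

namespace IsAsymptoticPolarCompression

variable {J : ∀ i, E i →ₗ[ℂ] H} {K : H →ₗᵢ[ℂ] H} {C B : ∀ i, E i → E i} {δ : ι → ℝ}
  (h : IsAsymptoticPolarCompression l J K C B δ)

include h

theorem eventually_abs_norm_sq_sub_le :
    ∀ᶠ i in l, ∀ a, |‖J i a‖ ^ 2 - ‖a‖ ^ 2| ≤ δ i * ‖a‖ ^ 2 := by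
  filter_upwards [h.inner_left] with i hi a
  have h1 := hi a a
  rw [inner_self_eq_norm_sq_to_K, inner_self_eq_norm_sq_to_K] at h1
  have h2 : ‖(((‖J i a‖ ^ 2 - ‖a‖ ^ 2 : ℝ)) : ℂ)‖ ≤ δ i * ‖a‖ * ‖a‖ := by
    push_cast
    exact h1
  rw [Complex.norm_real, Real.norm_eq_abs] at h2
  linarith

theorem tendsto_norm_sq {a : ∀ i, E i} {f : H} (ha : Tendsto (fun i => J i (a i)) l (𝓝 f)) :
    Tendsto (fun i => ‖a i‖ ^ 2) l (𝓝 (‖f‖ ^ 2)) := by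
  have h1 : Tendsto (fun i => ‖J i (a i)‖ ^ 2) l (𝓝 (‖f‖ ^ 2)) := ha.norm.pow 2
  have hlow : Tendsto (fun i => ‖J i (a i)‖ ^ 2 / (1 + δ i)) l (𝓝 (‖f‖ ^ 2)) := by
    have := h1.div (h.tendsto_zero.const_add 1) (by norm_num)
    rwa [add_zero, div_one] at this
  have hup : Tendsto (fun i => ‖J i (a i)‖ ^ 2 / (1 - δ i)) l (𝓝 (‖f‖ ^ 2)) := by
    have := h1.div (h.tendsto_zero.const_sub 1) (by norm_num)
    rwa [sub_zero, div_one] at this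
  refine tendsto_of_tendsto_of_tendsto_of_le_of_le' hlow hup ?_ ?_
  · filter_upwards [h.eventually_abs_norm_sq_sub_le] with i hi
    have h0 := h.nonneg i
    rw [div_le_iff₀ (by linarith)]
    linarith [(abs_le.1 (hi (a i))).2]
  · filter_upwards [h.eventually_abs_norm_sq_sub_le,
      h.tendsto_zero.eventually_lt_const one_pos] with i hi h1
    rw [le_div_iff₀ (by linarith)]
    linarith [(abs_le.1 (hi (a i))).1]

theorem eventually_norm_le : ∀ᶠ i in l, ∀ a, ‖J i a‖ ≤ 2 * ‖a‖ := by
  filter_upwards [h.eventually_abs_norm_sq_sub_le,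
    h.tendsto_zero.eventually_lt_const one_pos] with i hi h1 a
  refine le_of_sq_le_sq ?_ (by positivity)
  nlinarith [(abs_le.1 (hi a)).2, sq_nonneg ‖a‖]

theorem tendsto_zero_of_norm {a : ∀ i, E i} (ha : Tendsto (fun i => ‖a i‖) l (𝓝 0)) :
    Tendsto (fun i => J i (a i)) l (𝓝 0) := by
  rw [tendsto_zero_iff_norm_tendsto_zero]
  have h2 : Tendsto (fun i => 2 * ‖a i‖) l (𝓝 0) := by simpa using ha.const_mul 2
  refine squeeze_zero' (Eventually.of_forall fun i => norm_nonneg _) ?_ h2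
  filter_upwards [h.eventually_norm_le] with i hi using hi _

/-- Take `q` with `J q → K f` and test `d = C a - q` against itself: up to errors `δ ‖d‖ (‖a‖ +
‖q‖)`, `‖d‖²` is `⟨J d, K J a - J q⟩`, and `K J a - J q → 0`. Dividing by `‖d‖` gives `d → 0`. -/
theorem tendsto_compression {a : ∀ i, E i} {f : H}
    (ha : Tendsto (fun i => J i (a i)) l (𝓝 f)) :
    Tendsto (fun i => J i (C i (a i))) l (𝓝 (K f)) := by
  obtain ⟨q, hq⟩ := h.exists_tendsto (K f)
  have hKa : Tendsto (fun i => K (J i (a i))) l (𝓝 (K f)) := (K.continuous.tendsto f).comp ha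
  have hna : Tendsto (fun i => ‖a i‖) l (𝓝 ‖f‖) := by
    simpa using (h.tendsto_norm_sq ha).sqrt
  have hnq : Tendsto (fun i => ‖q i‖) l (𝓝 ‖K f‖) := by
    simpa using (h.tendsto_norm_sq hq).sqrt
  have hbound : Tendsto (fun i => 2 * ‖K (J i (a i)) - J i (q i)‖ + δ i * (‖a i‖ + ‖q i‖)) l
      (𝓝 0) := by
    simpa using ((hKa.sub hq).norm.const_mul 2).add (h.tendsto_zero.mul (hna.add hnq))
  have hd : Tendsto (fun i => ‖C i (a i) - q i‖) l (𝓝 0) := by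
    refine squeeze_zero' (Eventually.of_forall fun i => norm_nonneg _) ?_ hbound
    filter_upwards [h.eventually_norm_le, h.inner_left, h.inner_right] with i h1 h2 h3
    set d := C i (a i) - q i with hd
    have e1 := h3 d (a i)
    have e2 := h2 d (q i)
    have e3 : inner ℂ d d = inner ℂ d (C i (a i)) - inner ℂ d (q i) := by
      rw [← inner_sub_right]
    have e4 : inner ℂ d d = inner ℂ (J i d) (K (J i (a i)) - J i (q i)) -
        (inner ℂ (J i d) (K (J i (a i))) - inner ℂ d (C i (a i))) +
        (inner ℂ (J i d) (J i (q i)) - inner ℂ d (q i)) := by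
      rw [e3, inner_sub_right]; ring
    have e5 : ‖d‖ ^ 2 ≤ (2 * ‖d‖) * ‖K (J i (a i)) - J i (q i)‖ + δ i * ‖d‖ * ‖a i‖ +
        δ i * ‖d‖ * ‖q i‖ := by
      have : ‖d‖ ^ 2 = ‖inner ℂ d d‖ := by rw [inner_self_eq_norm_sq_to_K]; simp
      rw [this, e4]
      refine (norm_add_le _ _).trans (add_le_add ((norm_sub_le _ _).trans (add_le_add ?_ e1)) e2)
      exact (norm_inner_le_norm _ _).trans (by gcongr; exact h1 d)
    rcases (norm_nonneg d).eq_or_lt with h0 | h0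
    · rw [← h0]
      have := h.nonneg i
      positivity
    · refine le_of_mul_le_mul_left ?_ h0
      linarith
  have := (h.tendsto_zero_of_norm (a := fun i => C i (a i) - q i) hd).add hq
  simpa using this

/-- Asymptotically, the polar factors act like the isometry. -/
theorem tendsto_polar {a : ∀ i, E i} {f : H} (ha : Tendsto (fun i => J i (a i)) l (𝓝 f)) :
    Tendsto (fun i => J i (B i (a i))) l (𝓝 (K f)) := by
  have hC := h.tendsto_compression ha
  have hnC := h.tendsto_norm_sq hC
  have hna := h.tendsto_norm_sq ha
  rw [K.norm_map] at hnC
  -- Here the isometry of `K` enters: `‖a‖²` and `‖C a‖²` both tend to `‖f‖²`. The constant is `η =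
  -- (1 + 2δ)² - 1`, from the bound `‖C b‖ ≤ (1 + 2δ) ‖b‖` below.
  have hbound : Tendsto (fun i => (1 + 2 * (4 * δ i + 4 * δ i ^ 2)) * ‖a i‖ ^ 2 -
      ‖C i (a i)‖ ^ 2) l (𝓝 0) := by
    have := ((((h.tendsto_zero.const_mul 4).add ((h.tendsto_zero.pow 2).const_mul 4)).const_mul
      2).const_add 1).mul hna |>.sub hnC
    simpa using this
  have hsq : Tendsto (fun i => ‖B i (a i) - C i (a i)‖ ^ 2) l (𝓝 0) := by
    refine squeeze_zero' (Eventually.of_forall fun i => by positivity) ?_ hbound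
    filter_upwards [h.polar, h.eventually_abs_norm_sq_sub_le, h.inner_right] with i h1 h2 h3
    have hδ := h.nonneg i
    refine h1 _ (by positivity) (fun b => ?_) (a i)
    have hJ : ∀ x, ‖J i x‖ ≤ √(1 + δ i) * ‖x‖ := fun x => by
      rw [← Real.sqrt_sq (norm_nonneg (J i x)), ← Real.sqrt_sq (norm_nonneg x),
        ← Real.sqrt_mul (by positivity)]
      exact Real.sqrt_le_sqrt (by linarith [(abs_le.1 (h2 x)).2])
    set x := C i b
    have e1 : inner ℂ x x = inner ℂ (J i x) (K (J i b)) -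
        (inner ℂ (J i x) (K (J i b)) - inner ℂ x (C i b)) := by ring
    have e2 : ‖x‖ ^ 2 ≤ (√(1 + δ i) * ‖x‖) * (√(1 + δ i) * ‖b‖) + δ i * ‖x‖ * ‖b‖ := by
      have : ‖x‖ ^ 2 = ‖inner ℂ x x‖ := by rw [inner_self_eq_norm_sq_to_K]; simp
      rw [this, e1]
      refine (norm_sub_le _ _).trans (add_le_add ?_ (h3 x b))
      refine (norm_inner_le_norm _ _).trans ?_
      rw [K.norm_map]
      exact mul_le_mul (hJ x) (hJ b) (norm_nonneg _) (by positivity)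
    have e3 : √(1 + δ i) * √(1 + δ i) = 1 + δ i := Real.mul_self_sqrt (by positivity)
    have e4 : ‖x‖ * ‖x‖ ≤ ‖x‖ * ((1 + 2 * δ i) * ‖b‖) := by
      have : (√(1 + δ i) * ‖x‖) * (√(1 + δ i) * ‖b‖) = (1 + δ i) * (‖x‖ * ‖b‖) := by
        linear_combination (‖x‖ * ‖b‖) * e3
      rw [this] at e2
      linarith
    have e5 : ‖x‖ ≤ (1 + 2 * δ i) * ‖b‖ := by
      rcases (norm_nonneg x).eq_or_lt with h0 | h0
      · rw [← h0]; positivity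
      · exact le_of_mul_le_mul_left e4 h0
    calc ‖x‖ ^ 2 ≤ ((1 + 2 * δ i) * ‖b‖) ^ 2 := by gcongr
      _ = (1 + (4 * δ i + 4 * δ i ^ 2)) * ‖b‖ ^ 2 := by ring
  have hn : Tendsto (fun i => ‖B i (a i) - C i (a i)‖) l (𝓝 0) := by
    simpa using hsq.sqrt
  simpa using (h.tendsto_zero_of_norm (a := fun i => B i (a i) - C i (a i)) hn).add hC

theorem tendsto_iterate_polar {a : ∀ i, E i} {f : H} (ha : Tendsto (fun i => J i (a i)) l (𝓝 f))
    (n : ℕ) : Tendsto (fun i => J i ((B i)^[n] (a i))) l (𝓝 (K^[n] f)) := by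
  induction n with
  | zero => exact ha
  | succ n ih =>
    simp only [Function.iterate_succ', Function.comp]
    exact h.tendsto_polar ih

theorem tendsto_inner {a b : ∀ i, E i} {f g : H} (ha : Tendsto (fun i => J i (a i)) l (𝓝 f))
    (hb : Tendsto (fun i => J i (b i)) l (𝓝 g)) :
    Tendsto (fun i => inner ℂ (a i) (b i)) l (𝓝 (inner ℂ f g)) := by
  have hna : Tendsto (fun i => ‖a i‖) l (𝓝 ‖f‖) := by
    simpa using (h.tendsto_norm_sq ha).sqrt
  have hnb : Tendsto (fun i => ‖b i‖) l (𝓝 ‖g‖) := by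
    simpa using (h.tendsto_norm_sq hb).sqrt
  have h1 : Tendsto (fun i => inner ℂ (J i (a i)) (J i (b i)) - inner ℂ (a i) (b i)) l (𝓝 0) := by
    rw [tendsto_zero_iff_norm_tendsto_zero]
    have h2 : Tendsto (fun i => δ i * ‖a i‖ * ‖b i‖) l (𝓝 0) := by
      simpa using (h.tendsto_zero.mul hna).mul hnb
    refine squeeze_zero' (Eventually.of_forall fun i => norm_nonneg _) ?_ h2
    filter_upwards [h.inner_left] with i hi using hi _ _
  simpa using (ha.inner hb).sub h1

end IsAsymptoticPolarCompression

end AsymptoticCompression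

end MpEDMD

namespace MpEDMD

/-! ### Matrices of the algorithm as operators on Euclidean space -/

section MatrixOperators

open scoped ComplexOrder

variable {N : ℕ}

/-- The operator on Euclidean space given by a matrix. -/
abbrev euclideanOp (M : Matrix (Fin N) (Fin N) ℂ) :
    EuclideanSpace ℂ (Fin N) →L[ℂ] EuclideanSpace ℂ (Fin N) :=
  Matrix.toEuclideanCLM (n := Fin N) (𝕜 := ℂ) M

theorem inner_euclideanOp (M : Matrix (Fin N) (Fin N) ℂ) (a b : EuclideanSpace ℂ (Fin N)) :
    inner ℂ a (euclideanOp M b) = star a.ofLp ⬝ᵥ M *ᵥ b.ofLp := by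
  rw [EuclideanSpace.inner_eq_star_dotProduct, Matrix.ofLp_toEuclideanCLM, dotProduct_comm]

theorem norm_inner_euclideanOp_le (M : Matrix (Fin N) (Fin N) ℂ)
    (a b : EuclideanSpace ℂ (Fin N)) :
    ‖inner ℂ a (euclideanOp M b)‖ ≤ ‖euclideanOp M‖ * ‖a‖ * ‖b‖ := by
  refine (norm_inner_le_norm _ _).trans ?_
  have := (euclideanOp M).le_opNorm b
  calc ‖a‖ * ‖euclideanOp M b‖ ≤ ‖a‖ * (‖euclideanOp M‖ * ‖b‖) := by gcongr
    _ = _ := by ring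

theorem euclideanOp_mul_apply (M P : Matrix (Fin N) (Fin N) ℂ) (a : EuclideanSpace ℂ (Fin N)) :
    euclideanOp (M * P) a = euclideanOp M (euclideanOp P a) := by
  rw [euclideanOp, map_mul]
  rfl

theorem norm_euclideanOp_of_mem_unitary {U : Matrix (Fin N) (Fin N) ℂ}
    (hU : U ∈ Matrix.unitaryGroup (Fin N) ℂ) (a : EuclideanSpace ℂ (Fin N)) :
    ‖euclideanOp U a‖ = ‖a‖ :=
  ContinuousLinearMap.norm_map_of_mem_unitary
    (Unitary.map_mem (Matrix.toEuclideanCLM (n := Fin N) (𝕜 := ℂ)) hU) a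

theorem norm_sq_euclideanOp_diagonal (d : Fin N → ℂ) (a : EuclideanSpace ℂ (Fin N)) :
    ‖euclideanOp (Matrix.diagonal d) a‖ ^ 2 = ∑ j, ‖d j‖ ^ 2 * ‖a j‖ ^ 2 := by
  rw [EuclideanSpace.norm_sq_eq]
  refine Finset.sum_congr rfl fun j _ => ?_
  rw [Matrix.ofLp_toEuclideanCLM, Matrix.mulVec_diagonal, norm_mul, mul_pow]

theorem tendsto_euclideanOp {ι : Type*} {l : Filter ι} {M : ι → Matrix (Fin N) (Fin N) ℂ}
    {P : Matrix (Fin N) (Fin N) ℂ} (h : ∀ j k, Tendsto (fun i => M i j k) l (𝓝 (P j k))) :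
    Tendsto (fun i => euclideanOp (M i)) l (𝓝 (euclideanOp P)) := by
  have hM : Tendsto M l (𝓝 P) := tendsto_pi_nhds.2 fun j => tendsto_pi_nhds.2 (h j)
  have hc : Continuous
      (Matrix.toEuclideanCLM (n := Fin N) (𝕜 := ℂ)).toAlgEquiv.toLinearEquiv.toLinearMap :=
    LinearMap.continuous_of_finiteDimensional _
  exact (hc.tendsto P).comp hM

section SquareRoot

variable {G : Matrix (Fin N) (Fin N) ℂ}

theorem isHermitian_matSqrt (G : Matrix (Fin N) (Fin N) ℂ) : (matSqrt G).IsHermitian :=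
  (Matrix.nonneg_iff_posSemidef.1 (CFC.sqrt_nonneg G)).isHermitian

theorem matSqrt_mul_self (hG : G.PosDef) : matSqrt G * matSqrt G = G :=
  CFC.sqrt_mul_sqrt_self G hG.posSemidef.nonneg

theorem isUnit_det_matSqrt (hG : G.PosDef) : IsUnit (matSqrt G).det := by
  have h := (Matrix.isUnit_iff_isUnit_det G).1 hG.isUnit
  rw [← matSqrt_mul_self hG, Matrix.det_mul] at h
  exact isUnit_of_mul_isUnit_left h

theorem inv_matSqrt_mul_self (hG : G.PosDef) : (matSqrt G)⁻¹ * G = matSqrt G := by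
  calc (matSqrt G)⁻¹ * G = (matSqrt G)⁻¹ * (matSqrt G * matSqrt G) := by rw [matSqrt_mul_self hG]
    _ = matSqrt G := by
      rw [← mul_assoc, Matrix.nonsing_inv_mul _ (isUnit_det_matSqrt hG), one_mul]

theorem inv_matSqrt_mul_mul (hG : G.PosDef) : (matSqrt G)⁻¹ * G * (matSqrt G)⁻¹ = 1 := by
  rw [inv_matSqrt_mul_self hG, Matrix.mul_nonsing_inv _ (isUnit_det_matSqrt hG)]

/-- The C*-identity for the self-adjoint `G^{-1/2}`. It lets all error bounds involve `G⁻¹` only, so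
that continuity of the matrix square root is never needed. -/
theorem norm_euclideanOp_inv_matSqrt (hG : G.PosDef) :
    ‖euclideanOp (matSqrt G)⁻¹‖ * ‖euclideanOp (matSqrt G)⁻¹‖ = ‖euclideanOp G⁻¹‖ := by
  have h1 : (matSqrt G)⁻¹ * (matSqrt G)⁻¹ = G⁻¹ := by
    rw [← Matrix.mul_inv_rev, matSqrt_mul_self hG]
  have h2 : star (euclideanOp (matSqrt G)⁻¹) = euclideanOp (matSqrt G)⁻¹ := by
    rw [euclideanOp, ← map_star, Matrix.star_eq_conjTranspose, (isHermitian_matSqrt G).inv.eq]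
  rw [← CStarRing.norm_star_mul_self, h2, ← map_mul, h1]

theorem norm_euclideanOp_conj_le (hG : G.PosDef) (M : Matrix (Fin N) (Fin N) ℂ) :
    ‖euclideanOp ((matSqrt G)⁻¹ * M * (matSqrt G)⁻¹)‖ ≤ ‖euclideanOp G⁻¹‖ * ‖euclideanOp M‖ := by
  rw [← norm_euclideanOp_inv_matSqrt hG, euclideanOp, map_mul, map_mul]
  refine (norm_mul_le _ _).trans ?_
  have h := norm_mul_le (euclideanOp (matSqrt G)⁻¹) (euclideanOp M)
  calc _ ≤ ‖euclideanOp (matSqrt G)⁻¹‖ * ‖euclideanOp M‖ * ‖euclideanOp (matSqrt G)⁻¹‖ := by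
        gcongr
    _ = _ := by ring

theorem dotProduct_mulVec_eq_norm_sq (hG : G.PosDef) (c : Fin N → ℂ) :
    star c ⬝ᵥ G *ᵥ c = ((‖WithLp.toLp 2 (matSqrt G *ᵥ c)‖ ^ 2 : ℝ) : ℂ) := by
  have h := inner_self_eq_norm_sq_to_K (𝕜 := ℂ) (WithLp.toLp 2 (matSqrt G *ᵥ c))
  rw [EuclideanSpace.inner_toLp_toLp, dotProduct_comm, Matrix.star_mulVec,
    ← Matrix.dotProduct_mulVec, Matrix.mulVec_mulVec, (isHermitian_matSqrt G).eq,
    matSqrt_mul_self hG] at h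
  rw [h]
  push_cast
  rfl

/-- Hermitian matrices converging to a positive definite matrix are eventually positive
definite. -/
theorem eventually_posDef {ι : Type*} {l : Filter ι} {M : ι → Matrix (Fin N) (Fin N) ℂ}
    (hM : ∀ i, (M i).IsHermitian) (hG : G.PosDef)
    (h : ∀ j k, Tendsto (fun i => M i j k) l (𝓝 (G j k))) : ∀ᶠ i in l, (M i).PosDef := by
  have ht := (tendsto_iff_norm_sub_tendsto_zero.1 (tendsto_euclideanOp h))
  -- `‖x‖² ≤ κ x^* G x`, so a perturbation of norm below `1 / (κ + 1)` keeps the form positive; the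
  -- `+ 1` covers `κ = 0`, which occurs for `N = 0`.
  set κ := ‖euclideanOp (matSqrt G)⁻¹‖ ^ 2 with hκ
  have hκ0 : 0 ≤ κ := by positivity
  filter_upwards [ht.eventually_lt_const (show (0 : ℝ) < 1 / (κ + 1) by positivity)] with i hi
  refine Matrix.PosDef.of_dotProduct_mulVec_pos (hM i) fun x hx => ?_
  set a : EuclideanSpace ℂ (Fin N) := WithLp.toLp 2 x with ha
  have ha0 : 0 < ‖a‖ := by
    rw [norm_pos_iff]
    intro h0
    exact hx (by simpa [ha] using congrArg WithLp.ofLp h0)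
  have h1 : ‖a‖ ^ 2 ≤ κ * (star x ⬝ᵥ G *ᵥ x).re := by
    rw [dotProduct_mulVec_eq_norm_sq hG, Complex.ofReal_re, hκ, ← mul_pow]
    gcongr
    have h2 : a = euclideanOp (matSqrt G)⁻¹ (WithLp.toLp 2 (matSqrt G *ᵥ x)) := by
      rw [Matrix.toEuclideanCLM_toLp, Matrix.mulVec_mulVec,
        Matrix.nonsing_inv_mul _ (isUnit_det_matSqrt hG), Matrix.one_mulVec]
    conv_lhs => rw [h2]
    exact ContinuousLinearMap.le_opNorm _ _
  have h3 : (star x ⬝ᵥ G *ᵥ x).re - (star x ⬝ᵥ M i *ᵥ x).re ≤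
      ‖euclideanOp (M i) - euclideanOp G‖ * ‖a‖ * ‖a‖ := by
    have h4 : ‖euclideanOp (M i) - euclideanOp G‖ = ‖euclideanOp (G - M i)‖ := by
      rw [norm_sub_rev, euclideanOp, euclideanOp, euclideanOp, map_sub]
    rw [h4]
    refine le_trans ?_ (norm_inner_euclideanOp_le (G - M i) a a)
    rw [inner_euclideanOp, Matrix.sub_mulVec, dotProduct_sub, ← Complex.sub_re]
    exact Complex.re_le_norm _
  have him : (star x ⬝ᵥ M i *ᵥ x).im = 0 := (hM i).im_star_dotProduct_mulVec_self x
  rw [RCLike.pos_iff (K := ℂ)]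
  refine ⟨?_, him⟩
  change 0 < (star x ⬝ᵥ M i *ᵥ x).re
  have h5 : ‖euclideanOp (M i) - euclideanOp G‖ * (κ + 1) < 1 := by
    rwa [lt_div_iff₀ (by positivity)] at hi
  by_contra hneg
  push Not at hneg
  have h6 : (star x ⬝ᵥ G *ᵥ x).re ≤ ‖euclideanOp (M i) - euclideanOp G‖ * ‖a‖ ^ 2 := by
    nlinarith
  have h7 : ‖a‖ ^ 2 ≤ κ * (‖euclideanOp (M i) - euclideanOp G‖ * ‖a‖ ^ 2) :=
    h1.trans (mul_le_mul_of_nonneg_left h6 hκ0)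
  have h8 : 0 ≤ ‖euclideanOp (M i) - euclideanOp G‖ := norm_nonneg _
  have h9 : 0 < ‖a‖ ^ 2 := by positivity
  nlinarith

theorem tendsto_euclideanOp_inv {ι : Type*} {l : Filter ι} {M : ι → Matrix (Fin N) (Fin N) ℂ}
    (hG : G.PosDef) (h : ∀ j k, Tendsto (fun i => M i j k) l (𝓝 (G j k))) :
    Tendsto (fun i => euclideanOp (M i)⁻¹) l (𝓝 (euclideanOp G⁻¹)) := by
  have hM : Tendsto M l (𝓝 G) := tendsto_pi_nhds.2 fun j => tendsto_pi_nhds.2 (h j)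
  have hdet : G.det ≠ 0 := ((Matrix.isUnit_iff_isUnit_det G).1 hG.isUnit).ne_zero
  have hc : ContinuousAt Inv.inv G := continuousAt_matrix_inv G (by
    rw [Ring.inverse_eq_inv']
    exact continuousAt_inv₀ hdet)
  have hinv : Tendsto (fun i => (M i)⁻¹) l (𝓝 G⁻¹) := hc.tendsto.comp hM
  exact tendsto_euclideanOp fun j k => tendsto_pi_nhds.1 (tendsto_pi_nhds.1 hinv j) k

end SquareRoot

section RunProperties

variable {G A : Matrix (Fin N) (Fin N) ℂ} (r : Run G A)

/-- The algorithm decomposes the adjoint of this matrix. Taking adjoints exhibits `U₂ U₁^*` as a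
unitary polar factor. -/
theorem Run.compression_eq : (matSqrt G)⁻¹ * A * (matSqrt G)⁻¹ =
    r.U₂ * Matrix.diagonal (fun j => (r.sing j : ℂ)) * r.U₁ᴴ := by
  have h := congrArg Matrix.conjTranspose r.svd
  simp only [Matrix.conjTranspose_mul, Matrix.conjTranspose_conjTranspose,
    (isHermitian_matSqrt G).inv.eq, Matrix.diagonal_conjTranspose] at h
  rw [mul_assoc, h, mul_assoc]
  congr 3
  ext j
  simp

theorem conjTranspose_mem_unitaryGroup {U : Matrix (Fin N) (Fin N) ℂ}
    (hU : U ∈ Matrix.unitaryGroup (Fin N) ℂ) : Uᴴ ∈ Matrix.unitaryGroup (Fin N) ℂ :=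
  Unitary.star_mem hU

/-- In singular coordinates the difference is multiplication by `1 - σ_j`, so the claim reduces to
`(1 - σ)² ≤ 1 + 2η - σ²`, that is `σ² - σ ≤ η`. This follows from `σ² ≤ 1 + η`, treating `σ ≤ 1` and
`σ ≥ 1` separately. -/
theorem Run.norm_polar_sub_le {η : ℝ} (hη : 0 ≤ η)
    (hC : ∀ a, ‖euclideanOp ((matSqrt G)⁻¹ * A * (matSqrt G)⁻¹) a‖ ^ 2 ≤ (1 + η) * ‖a‖ ^ 2)
    (a : EuclideanSpace ℂ (Fin N)) :
    ‖euclideanOp (r.U₂ * r.U₁ᴴ) a - euclideanOp ((matSqrt G)⁻¹ * A * (matSqrt G)⁻¹) a‖ ^ 2 ≤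
      (1 + 2 * η) * ‖a‖ ^ 2 - ‖euclideanOp ((matSqrt G)⁻¹ * A * (matSqrt G)⁻¹) a‖ ^ 2 := by
  have hU₁ := conjTranspose_mem_unitaryGroup r.U₁_mem
  have hnormC : ∀ b, ‖euclideanOp ((matSqrt G)⁻¹ * A * (matSqrt G)⁻¹) b‖ ^ 2 =
      ∑ j, r.sing j ^ 2 * ‖euclideanOp r.U₁ᴴ b j‖ ^ 2 := fun b => by
    rw [r.compression_eq, euclideanOp_mul_apply, euclideanOp_mul_apply,
      norm_euclideanOp_of_mem_unitary r.U₂_mem, norm_sq_euclideanOp_diagonal]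
    simp
  have hnorm : ∀ b, ‖b‖ ^ 2 = ∑ j, ‖euclideanOp r.U₁ᴴ b j‖ ^ 2 := fun b => by
    rw [← norm_euclideanOp_of_mem_unitary hU₁, EuclideanSpace.norm_sq_eq]
  -- Evaluate the norm bound at the `j`-th singular vector `U₁ e_j`.
  have hsing : ∀ j, r.sing j ^ 2 ≤ 1 + η := fun j => by
    have h1 := hC (euclideanOp r.U₁ (EuclideanSpace.single j 1))
    have h2 : euclideanOp r.U₁ᴴ (euclideanOp r.U₁ (EuclideanSpace.single j 1)) =
        EuclideanSpace.single j 1 := by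
      rw [← euclideanOp_mul_apply]
      have : r.U₁ᴴ * r.U₁ = 1 := Matrix.mem_unitaryGroup_iff'.1 r.U₁_mem
      rw [this, euclideanOp, map_one]
      rfl
    rw [hnormC, h2, norm_euclideanOp_of_mem_unitary r.U₁_mem, Finset.sum_eq_single j] at h1
    · simpa using h1
    · intro k _ hk
      simp [hk]
    · simp
  have hdiff : euclideanOp (r.U₂ * r.U₁ᴴ) a - euclideanOp ((matSqrt G)⁻¹ * A * (matSqrt G)⁻¹) a =
      euclideanOp (r.U₂ * Matrix.diagonal (fun j => (1 - r.sing j : ℂ)) * r.U₁ᴴ) a := by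
    have : r.U₂ * Matrix.diagonal (fun j => (1 - r.sing j : ℂ)) * r.U₁ᴴ =
        r.U₂ * r.U₁ᴴ - (matSqrt G)⁻¹ * A * (matSqrt G)⁻¹ := by
      rw [r.compression_eq, ← Matrix.diagonal_sub, Matrix.diagonal_one, mul_sub, sub_mul, mul_one]
    rw [this, euclideanOp, euclideanOp, euclideanOp, map_sub]
    rfl
  rw [hdiff, euclideanOp_mul_apply, euclideanOp_mul_apply,
    norm_euclideanOp_of_mem_unitary r.U₂_mem, norm_sq_euclideanOp_diagonal, hnormC, hnorm a,
    Finset.mul_sum, ← Finset.sum_sub_distrib]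
  refine Finset.sum_le_sum fun j _ => ?_
  rw [← sub_mul]
  refine mul_le_mul_of_nonneg_right ?_ (by positivity)
  have h1 : ‖(1 - r.sing j : ℂ)‖ ^ 2 = (1 - r.sing j) ^ 2 := by
    rw [← Complex.ofReal_one, ← Complex.ofReal_sub, Complex.norm_real, Real.norm_eq_abs, sq_abs]
  rw [h1]
  have h2 := r.sing_nonneg j
  have h3 := hsing j
  rcases le_total (r.sing j) 1 with h | h <;> nlinarith

/-- The weights are thus squared coordinates of `G^{1/2} c` in the orthonormal eigenbasis `V̂` of
`U₂ U₁^*`, and the measure is the spectral measure of that unitary matrix at `G^{1/2} c`. -/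
theorem Run.rawMeasure_weight (hG : G.PosDef) (c : Fin N → ℂ) (j : Fin N) :
    star (fun i => r.V i j) ⬝ᵥ G *ᵥ c =
      euclideanOp r.Vhatᴴ (WithLp.toLp 2 (matSqrt G *ᵥ c)) j := by
  have h1 : star (fun i => r.V i j) ⬝ᵥ G *ᵥ c = (r.Vᴴ *ᵥ (G *ᵥ c)) j := rfl
  rw [h1, Matrix.toEuclideanCLM_toLp, Run.V, Matrix.conjTranspose_mul,
    (isHermitian_matSqrt G).inv.eq, Matrix.mulVec_mulVec, mul_assoc, inv_matSqrt_mul_self hG,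
    Matrix.mulVec_mulVec]

theorem Run.isProbabilityMeasure_rawMeasure (hG : G.PosDef) {c : Fin N → ℂ}
    (hc : ‖WithLp.toLp 2 (matSqrt G *ᵥ c)‖ = 1) : IsProbabilityMeasure (r.rawMeasure c) := by
  refine ⟨?_⟩
  have h := norm_euclideanOp_of_mem_unitary (conjTranspose_mem_unitaryGroup r.Vhat_mem)
    (WithLp.toLp 2 (matSqrt G *ᵥ c))
  rw [hc, ← sq_eq_sq₀ (norm_nonneg _) zero_le_one, EuclideanSpace.norm_sq_eq] at h
  rw [Run.rawMeasure, Measure.finsetSum_apply]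
  simp only [Measure.smul_apply, measure_univ, smul_eq_mul, mul_one, r.rawMeasure_weight hG]
  rw [← ENNReal.ofReal_sum_of_nonneg (fun _ _ => by positivity), h]
  simp

theorem Run.polar_pow (n : ℕ) : (r.U₂ * r.U₁ᴴ) ^ n =
    r.Vhat * Matrix.diagonal (fun j => (r.eig j : ℂ) ^ n) * r.Vhatᴴ := by
  have hV : r.Vhatᴴ * r.Vhat = 1 := Matrix.mem_unitaryGroup_iff'.1 r.Vhat_mem
  have hV' : r.Vhat * r.Vhatᴴ = 1 := Matrix.mem_unitaryGroup_iff.1 r.Vhat_mem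
  induction n with
  | zero => simp [hV']
  | succ n ih =>
    rw [pow_succ, ih, r.eigendecomposition]
    calc _ = r.Vhat * Matrix.diagonal (fun j => (r.eig j : ℂ) ^ n) * (r.Vhatᴴ * r.Vhat) *
          Matrix.diagonal (fun j => (r.eig j : ℂ)) * r.Vhatᴴ := by simp only [mul_assoc]
      _ = _ := by
        rw [hV, mul_one, mul_assoc r.Vhat, Matrix.diagonal_mul_diagonal]
        simp only [pow_succ]

theorem Run.integral_pow_rawMeasure (hG : G.PosDef) (c : Fin N → ℂ) (n : ℕ) :
    ∫ z, (z : ℂ) ^ n ∂(r.rawMeasure c) =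
      inner ℂ (WithLp.toLp 2 (matSqrt G *ᵥ c))
        (euclideanOp ((r.U₂ * r.U₁ᴴ) ^ n) (WithLp.toLp 2 (matSqrt G *ᵥ c))) := by
  set u : EuclideanSpace ℂ (Fin N) := WithLp.toLp 2 (matSqrt G *ᵥ c) with hu
  have h1 : ∫ z, (z : ℂ) ^ n ∂(r.rawMeasure c) =
      ∑ j, ((‖euclideanOp r.Vhatᴴ u j‖ ^ 2 : ℝ) : ℂ) * (r.eig j : ℂ) ^ n := by
    rw [Run.rawMeasure, integral_finsetSum_measure]
    · refine Finset.sum_congr rfl fun j _ => ?_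
      rw [integral_smul_measure, integral_dirac, r.rawMeasure_weight hG,
        ENNReal.toReal_ofReal (by positivity), Complex.real_smul]
    · intro j _
      exact ((Circle.integrable_of_continuous (by fun_prop) _).smul_measure ENNReal.ofReal_ne_top)
  rw [h1, r.polar_pow, euclideanOp_mul_apply, euclideanOp_mul_apply,
    ← ContinuousLinearMap.adjoint_inner_left]
  have h2 : ContinuousLinearMap.adjoint (euclideanOp r.Vhat) = euclideanOp r.Vhatᴴ :=
    (map_star (Matrix.toEuclideanCLM (n := Fin N) (𝕜 := ℂ)) r.Vhat).symm
  rw [h2, inner_euclideanOp, dotProduct]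
  refine Finset.sum_congr rfl fun j _ => ?_
  rw [Matrix.mulVec_diagonal, Pi.star_apply, Complex.star_def]
  have := Complex.conj_mul' (euclideanOp r.Vhatᴴ u j)
  rw [mul_left_comm, this]
  push_cast
  ring

end RunProperties

end MatrixOperators

end MpEDMD

namespace MpEDMD

universe u

/-! ### Iterated limits as limits along a curried filter -/

section IteratedLimits

/-- Along this filter a property holds eventually if, for all large `N`, it holds for all `M` beyond
a threshold depending on `N`; no uniformity in `N` is required. -/
theorem tendsto_curry_of_tendsto {X : Type*} [PseudoMetricSpace X] {f : ℕ × ℕ → X} {b : ℕ → X}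
    {x : X} (hf : ∀ N, Tendsto (fun M => f (N, M)) atTop (𝓝 (b N))) (hb : Tendsto b atTop (𝓝 x)) :
    Tendsto f ((atTop : Filter ℕ).curry atTop) (𝓝 x) := by
  rw [Metric.tendsto_nhds]
  intro ε hε
  rw [Filter.eventually_curry_iff]
  filter_upwards [Metric.tendsto_nhds.1 hb (ε / 2) (by positivity)] with N hN
  filter_upwards [Metric.tendsto_nhds.1 (hf N) (ε / 2) (by positivity)] with M hM
  linarith [dist_triangle (f (N, M)) (b N) x]

theorem eventually_curry_of_forall {p : ℕ × ℕ → Prop} (h : ∀ N, ∀ᶠ M in atTop, p (N, M)) :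
    ∀ᶠ i in (atTop : Filter ℕ).curry atTop, p i :=
  Filter.eventually_curry_iff.2 (Eventually.of_forall h)

theorem tendsto_limsup_of_tendsto_curry {f : ℕ × ℕ → ℝ≥0∞}
    (h : Tendsto f ((atTop : Filter ℕ).curry atTop) (𝓝 0)) :
    Tendsto (fun N => limsup (fun M => f (N, M)) atTop) atTop (𝓝 0) := by
  rw [ENNReal.tendsto_nhds_zero] at h ⊢
  intro ε hε
  filter_upwards [Filter.eventually_curry_iff.1 (h ε hε)] with N hN
  exact limsup_le_of_le (by isBoundedDefault) hN

end IteratedLimits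

/-! ### Galerkin matrices and normalized coordinates -/

section Synthesis

open scoped ComplexOrder

variable {Ω : Type u} [MeasurableSpace Ω] {ω : Measure Ω} {N : ℕ}

theorem synthesis_smul (φ : Fin N → Lp ℂ 2 ω) (t : ℂ) (c : Fin N → ℂ) :
    synthesis φ (t • c) = t • synthesis φ c := by
  simp [synthesis, Finset.smul_sum, smul_smul]

theorem synthesis_add (φ : Fin N → Lp ℂ 2 ω) (a b : Fin N → ℂ) :
    synthesis φ (a + b) = synthesis φ a + synthesis φ b := by
  simp [synthesis, add_smul, Finset.sum_add_distrib]

/-- The matrix of a linear operator with respect to the dictionary `φ`. -/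
def galerkinMatrix (φ : Fin N → Lp ℂ 2 ω) (L : Lp ℂ 2 ω →ₗ[ℂ] Lp ℂ 2 ω) :
    Matrix (Fin N) (Fin N) ℂ :=
  Matrix.of fun j k => inner ℂ (φ j) (L (φ k))

theorem inner_synthesis (φ : Fin N → Lp ℂ 2 ω) (L : Lp ℂ 2 ω →ₗ[ℂ] Lp ℂ 2 ω)
    (a b : Fin N → ℂ) :
    inner ℂ (synthesis φ a) (L (synthesis φ b)) = star a ⬝ᵥ galerkinMatrix φ L *ᵥ b := by
  simp only [synthesis, map_sum, map_smul, sum_inner, inner_sum, inner_smul_left,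
    inner_smul_right, dotProduct, Matrix.mulVec, galerkinMatrix, Matrix.of_apply, Pi.star_apply,
    Complex.star_def, Finset.mul_sum]
  rw [Finset.sum_comm]
  refine Finset.sum_congr rfl fun j _ => Finset.sum_congr rfl fun k _ => ?_
  ring

/-- The map `a ↦ Ψ G^{-1/2} a` from coordinates to functions. -/
def normalizedSynthesis (φ : Fin N → Lp ℂ 2 ω) (G : Matrix (Fin N) (Fin N) ℂ) :
    EuclideanSpace ℂ (Fin N) →ₗ[ℂ] Lp ℂ 2 ω where
  toFun a := synthesis φ ((matSqrt G)⁻¹ *ᵥ a.ofLp)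
  map_add' a b := by rw [WithLp.ofLp_add, Matrix.mulVec_add, synthesis_add]
  map_smul' t a := by
    rw [WithLp.ofLp_smul, Matrix.mulVec_smul, synthesis_smul, RingHom.id_apply]

theorem normalizedSynthesis_matSqrt (φ : Fin N → Lp ℂ 2 ω) {G : Matrix (Fin N) (Fin N) ℂ}
    (hG : G.PosDef) (c : Fin N → ℂ) :
    normalizedSynthesis φ G (WithLp.toLp 2 (matSqrt G *ᵥ c)) = synthesis φ c := by
  change synthesis φ ((matSqrt G)⁻¹ *ᵥ (matSqrt G *ᵥ c)) = _
  rw [Matrix.mulVec_mulVec, Matrix.nonsing_inv_mul _ (isUnit_det_matSqrt hG), Matrix.one_mulVec]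

/-- The form of `L` pulled back by `Ψ G^{-1/2}` is exactly that of `G^{-1/2} L_φ G^{-1/2}`, with
`L_φ` its Galerkin matrix, so only the quadrature error `L_φ - A` remains. It is used for the
identity and for the Koopman operator. -/
theorem norm_inner_normalizedSynthesis_sub_le (φ : Fin N → Lp ℂ 2 ω)
    (L : Lp ℂ 2 ω →ₗ[ℂ] Lp ℂ 2 ω) {G : Matrix (Fin N) (Fin N) ℂ} (hG : G.PosDef)
    (A : Matrix (Fin N) (Fin N) ℂ) (a b : EuclideanSpace ℂ (Fin N)) :
    ‖inner ℂ (normalizedSynthesis φ G a) (L (normalizedSynthesis φ G b)) -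
      inner ℂ a (euclideanOp ((matSqrt G)⁻¹ * A * (matSqrt G)⁻¹) b)‖ ≤
      ‖euclideanOp G⁻¹‖ * ‖euclideanOp (galerkinMatrix φ L - A)‖ * ‖a‖ * ‖b‖ := by
  have h : ∀ P : Matrix (Fin N) (Fin N) ℂ,
      inner ℂ a (euclideanOp ((matSqrt G)⁻¹ * P * (matSqrt G)⁻¹) b) =
        star ((matSqrt G)⁻¹ *ᵥ a.ofLp) ⬝ᵥ P *ᵥ ((matSqrt G)⁻¹ *ᵥ b.ofLp) := fun P => by
    rw [inner_euclideanOp, Matrix.star_mulVec, ← Matrix.dotProduct_mulVec,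
      (isHermitian_matSqrt G).inv.eq, Matrix.mulVec_mulVec, Matrix.mulVec_mulVec, mul_assoc]
  have h1 : inner ℂ (normalizedSynthesis φ G a) (L (normalizedSynthesis φ G b)) =
      inner ℂ a (euclideanOp ((matSqrt G)⁻¹ * galerkinMatrix φ L * (matSqrt G)⁻¹) b) := by
    rw [h]
    exact inner_synthesis φ L _ _
  have h2 : inner ℂ a (euclideanOp ((matSqrt G)⁻¹ * galerkinMatrix φ L * (matSqrt G)⁻¹) b) -
      inner ℂ a (euclideanOp ((matSqrt G)⁻¹ * A * (matSqrt G)⁻¹) b) =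
      inner ℂ a (euclideanOp ((matSqrt G)⁻¹ * (galerkinMatrix φ L - A) * (matSqrt G)⁻¹) b) := by
    rw [h, h, h, Matrix.sub_mulVec, dotProduct_sub]
  rw [h1, h2]
  refine (norm_inner_euclideanOp_le _ _ _).trans ?_
  gcongr
  exact norm_euclideanOp_conj_le hG _

omit [MeasurableSpace Ω] in
theorem isHermitian_gramMatrix {M : ℕ} (ψ : Fin N → Ω → ℂ) (w : Fin M → ℝ) (x : Fin M → Ω) :
    (gramMatrix ψ w x).IsHermitian := by
  unfold Matrix.IsHermitian gramMatrix weightedProduct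
  have hd : star (fun m => (w m : ℂ)) = fun m => (w m : ℂ) := by
    ext m
    simp
  rw [Matrix.conjTranspose_mul, Matrix.conjTranspose_mul, Matrix.conjTranspose_conjTranspose,
    Matrix.diagonal_conjTranspose, hd, Matrix.mul_assoc]

theorem iterate_euclideanOp (M : Matrix (Fin N) (Fin N) ℂ) (n : ℕ)
    (a : EuclideanSpace ℂ (Fin N)) : (euclideanOp M)^[n] a = euclideanOp (M ^ n) a := by
  induction n generalizing a with
  | zero => simp [euclideanOp]
  | succ n ih => rw [Function.iterate_succ, Function.comp, ih, pow_succ, euclideanOp_mul_apply]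

theorem norm_matSqrt_normalize {G : Matrix (Fin N) (Fin N) ℂ} (hG : G.PosDef) {c : Fin N → ℂ}
    (hc : 0 < (star c ⬝ᵥ G *ᵥ c).re) :
    ‖WithLp.toLp 2 (matSqrt G *ᵥ normalize G c)‖ = 1 := by
  rw [dotProduct_mulVec_eq_norm_sq hG, Complex.ofReal_re] at hc
  have h0 : ‖WithLp.toLp 2 (matSqrt G *ᵥ c)‖ ≠ 0 := fun h => by simp [h] at hc
  rw [normalize, dotProduct_mulVec_eq_norm_sq hG, Complex.ofReal_re, Real.sqrt_sq (norm_nonneg _),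
    Matrix.mulVec_smul, WithLp.toLp_smul, norm_smul, Complex.norm_real, norm_inv, norm_norm,
    inv_mul_cancel₀ h0]

end Synthesis

/-! ### Convergence of mpEDMD -/

section Convergence

open scoped ComplexOrder

variable {Ω : Type u} [MeasurableSpace Ω] {ω : Measure Ω} {K : Lp ℂ 2 ω →ₗᵢ[ℂ] Lp ℂ 2 ω}
  {φ : ∀ N : ℕ, Fin N → Lp ℂ 2 ω} {G A : ∀ N : ℕ, ℕ → Matrix (Fin N) (Fin N) ℂ}
  (run : ∀ N M : ℕ, Run (G N M) (A N M))

theorem posDef_galerkinMatrix_id {N : ℕ} {φ : Fin N → Lp ℂ 2 ω} (h : LinearIndependent ℂ φ) :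
    (galerkinMatrix φ LinearMap.id).PosDef :=
  Matrix.posDef_gram_of_linearIndependent h

/-- Under convergence of the quadrature, the matrices of mpEDMD are asymptotic polar compressions
of the Koopman operator. -/
theorem Run.isAsymptoticPolarCompression (hind : ∀ N, LinearIndependent ℂ (φ N))
    (hdense : ∀ h : Lp ℂ 2 ω, Tendsto (fun N => Metric.infDist h
      (Submodule.span ℂ (Set.range (φ N)) : Set (Lp ℂ 2 ω))) atTop (𝓝 0))
    (hherm : ∀ N M, (G N M).IsHermitian)
    (hG : ∀ N j k, Tendsto (fun M => G N M j k) atTop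
      (𝓝 (galerkinMatrix (φ N) LinearMap.id j k)))
    (hA : ∀ N j k, Tendsto (fun M => A N M j k) atTop
      (𝓝 (galerkinMatrix (φ N) K.toLinearMap j k))) :
    IsAsymptoticPolarCompression (E := fun p : ℕ × ℕ => EuclideanSpace ℂ (Fin p.1))
      ((atTop : Filter ℕ).curry atTop)
      (fun p => normalizedSynthesis (φ p.1) (G p.1 p.2)) K
      (fun p => euclideanOp ((matSqrt (G p.1 p.2))⁻¹ * A p.1 p.2 * (matSqrt (G p.1 p.2))⁻¹))
      (fun p => euclideanOp ((run p.1 p.2).U₂ * (run p.1 p.2).U₁ᴴ))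
      (fun p => ‖euclideanOp (G p.1 p.2)⁻¹‖ *
        (‖euclideanOp (galerkinMatrix (φ p.1) LinearMap.id - G p.1 p.2)‖ +
          ‖euclideanOp (galerkinMatrix (φ p.1) K.toLinearMap - A p.1 p.2)‖)) := by
  have hpos : ∀ᶠ p : ℕ × ℕ in (atTop : Filter ℕ).curry atTop, (G p.1 p.2).PosDef :=
    eventually_curry_of_forall fun N =>
      eventually_posDef (hherm N) (posDef_galerkinMatrix_id (hind N)) (hG N)
  refine ⟨fun p => by positivity, ?_, ?_, ?_, fun f => ?_, ?_⟩
  -- For fixed `N` the quadrature errors vanish while `‖G⁻¹‖` converges. Its limit may grow with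
  -- `N`, which is harmless because `M → ∞` is taken first.
  · refine tendsto_curry_of_tendsto (b := fun _ => 0) (fun N => ?_) tendsto_const_nhds
    have h1 := (tendsto_euclideanOp_inv (posDef_galerkinMatrix_id (hind N)) (hG N)).norm
    have h2 : ∀ {L : Lp ℂ 2 ω →ₗ[ℂ] Lp ℂ 2 ω} {P : ℕ → Matrix (Fin N) (Fin N) ℂ},
        (∀ j k, Tendsto (fun M => P M j k) atTop (𝓝 (galerkinMatrix (φ N) L j k))) →
        Tendsto (fun M => ‖euclideanOp (galerkinMatrix (φ N) L - P M)‖) atTop (𝓝 0) := by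
      intro L P h
      have := tendsto_iff_norm_sub_tendsto_zero.1 (tendsto_euclideanOp h)
      refine this.congr fun M => ?_
      rw [norm_sub_rev, euclideanOp, euclideanOp, euclideanOp, map_sub]
    simpa using h1.mul ((h2 (hG N)).add (h2 (hA N)))
  · filter_upwards [hpos] with p hp a b
    have h1 := norm_inner_normalizedSynthesis_sub_le (φ p.1) LinearMap.id hp (G p.1 p.2) a b
    rw [inv_matSqrt_mul_mul hp, euclideanOp, map_one] at h1
    refine h1.trans ?_
    gcongr
    exact le_add_of_nonneg_right (norm_nonneg _)
  · filter_upwards [hpos] with p hp a b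
    refine (norm_inner_normalizedSynthesis_sub_le (φ p.1) K.toLinearMap hp (A p.1 p.2) a b).trans ?_
    gcongr
    exact le_add_of_nonneg_left (norm_nonneg _)
  · have hex : ∀ N : ℕ, ∃ b : Fin N → ℂ, dist f (synthesis (φ N) b) <
        Metric.infDist f (Submodule.span ℂ (Set.range (φ N)) : Set (Lp ℂ 2 ω)) + 1 / (N + 1) := by
      intro N
      obtain ⟨y, hy, hd⟩ := (Metric.infDist_lt_iff (Submodule.nonempty _)).1
        (lt_add_of_pos_right (Metric.infDist f
          (Submodule.span ℂ (Set.range (φ N)) : Set (Lp ℂ 2 ω)))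
          (show (0 : ℝ) < 1 / (N + 1) by positivity))
      obtain ⟨b, rfl⟩ := (Submodule.mem_span_range_iff_exists_fun ℂ).1 hy
      exact ⟨b, hd⟩
    choose b hb using hex
    have hlim : Tendsto (fun N => synthesis (φ N) (b N)) atTop (𝓝 f) := by
      rw [tendsto_iff_dist_tendsto_zero]
      have h0 : Tendsto (fun N : ℕ => Metric.infDist f
          (Submodule.span ℂ (Set.range (φ N)) : Set (Lp ℂ 2 ω)) + 1 / ((N : ℝ) + 1)) atTop
          (𝓝 0) := by
        simpa using (hdense f).add tendsto_one_div_add_atTop_nhds_zero_nat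
      refine squeeze_zero (fun _ => dist_nonneg) (fun N => ?_) h0
      rw [dist_comm]
      exact (hb N).le
    refine ⟨fun p => WithLp.toLp 2 (matSqrt (G p.1 p.2) *ᵥ b p.1), ?_⟩
    have h1 : Tendsto (fun p : ℕ × ℕ => synthesis (φ p.1) (b p.1))
        ((atTop : Filter ℕ).curry atTop) (𝓝 f) :=
      tendsto_curry_of_tendsto (fun N => tendsto_const_nhds) hlim
    refine h1.congr' ?_
    filter_upwards [hpos] with p hp
    rw [normalizedSynthesis_matSqrt _ hp]
  · exact Eventually.of_forall fun p η hη hC a => (run p.1 p.2).norm_polar_sub_le hη hC a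

theorem Run.tendsto_W1 (hind : ∀ N, LinearIndependent ℂ (φ N))
    (hdense : ∀ h : Lp ℂ 2 ω, Tendsto (fun N => Metric.infDist h
      (Submodule.span ℂ (Set.range (φ N)) : Set (Lp ℂ 2 ω))) atTop (𝓝 0))
    (hherm : ∀ N M, (G N M).IsHermitian)
    (hG : ∀ N j k, Tendsto (fun M => G N M j k) atTop
      (𝓝 (galerkinMatrix (φ N) LinearMap.id j k)))
    (hA : ∀ N j k, Tendsto (fun M => A N M j k) atTop
      (𝓝 (galerkinMatrix (φ N) K.toLinearMap j k)))
    {g : Lp ℂ 2 ω} (hg : ‖g‖ = 1) {c : ∀ N : ℕ, Fin N → ℂ}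
    (hc : Tendsto (fun N => synthesis (φ N) (c N)) atTop (𝓝 g)) :
    Tendsto (fun p : ℕ × ℕ => W1 (MpEDMD.spectralMeasure K g)
      ((run p.1 p.2).spectralMeasure (c p.1))) ((atTop : Filter ℕ).curry atTop) (𝓝 0) := by
  have hpos : ∀ᶠ p : ℕ × ℕ in (atTop : Filter ℕ).curry atTop, (G p.1 p.2).PosDef :=
    eventually_curry_of_forall fun N =>
      eventually_posDef (hherm N) (posDef_galerkinMatrix_id (hind N)) (hG N)
  have hcomp := Run.isAsymptoticPolarCompression run hind hdense hherm hG hA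
  -- The limit in `M` is `‖Ψ c_N‖²`, which tends to `‖g‖² = 1`. So normalizing `c` is eventually
  -- legitimate and does not change the limit of `Ψ c`.
  have hnorm : Tendsto (fun p : ℕ × ℕ => (star (c p.1) ⬝ᵥ G p.1 p.2 *ᵥ c p.1).re)
      ((atTop : Filter ℕ).curry atTop) (𝓝 1) := by
    refine tendsto_curry_of_tendsto (b := fun N => ‖synthesis (φ N) (c N)‖ ^ 2) (fun N => ?_) ?_
    · have h1 : ‖synthesis (φ N) (c N)‖ ^ 2 =
          (star (c N) ⬝ᵥ galerkinMatrix (φ N) LinearMap.id *ᵥ c N).re := by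
        rw [← inner_synthesis, LinearMap.id_apply, inner_self_eq_norm_sq_to_K]
        norm_cast
      have h2 := ((ContinuousLinearMap.apply ℂ _ (WithLp.toLp 2 (c N))).continuous.tendsto _).comp
        (tendsto_euclideanOp (hG N))
      have h3 := (Complex.continuous_re.tendsto _).comp
        (Tendsto.inner (𝕜 := ℂ) (tendsto_const_nhds (x := WithLp.toLp 2 (c N))) h2)
      rw [h1]
      have h4 : ∀ P : Matrix (Fin N) (Fin N) ℂ, star (c N) ⬝ᵥ P *ᵥ c N =
          inner ℂ (WithLp.toLp 2 (c N)) (euclideanOp P (WithLp.toLp 2 (c N))) := fun P =>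
        (inner_euclideanOp P _ _).symm
      simp only [h4]
      exact h3
    · have := hc.norm.pow 2
      rwa [hg, one_pow] at this
  have hnpos := hnorm.eventually_const_lt (show (0 : ℝ) < 1 by norm_num)
  have hsyn : Tendsto (fun p : ℕ × ℕ => synthesis (φ p.1) (c p.1))
      ((atTop : Filter ℕ).curry atTop) (𝓝 g) :=
    tendsto_curry_of_tendsto (fun N => tendsto_const_nhds) hc
  set a : ∀ p : ℕ × ℕ, EuclideanSpace ℂ (Fin p.1) := fun p =>
    WithLp.toLp 2 (matSqrt (G p.1 p.2) *ᵥ normalize (G p.1 p.2) (c p.1)) with ha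
  have hJ : Tendsto (fun p : ℕ × ℕ => normalizedSynthesis (φ p.1) (G p.1 p.2) (a p))
      ((atTop : Filter ℕ).curry atTop) (𝓝 g) := by
    have h1 : Tendsto (fun p : ℕ × ℕ =>
        (((√(star (c p.1) ⬝ᵥ G p.1 p.2 *ᵥ c p.1).re)⁻¹ : ℝ) : ℂ) • synthesis (φ p.1) (c p.1))
        ((atTop : Filter ℕ).curry atTop) (𝓝 g) := by
      have h2 := (Complex.continuous_ofReal.tendsto _).comp (hnorm.sqrt.inv₀ (by simp))
      have h3 := h2.smul hsyn
      simpa using h3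
    refine h1.congr' ?_
    filter_upwards [hpos] with p hp
    rw [ha, normalizedSynthesis_matSqrt _ hp, normalize, synthesis_smul]
  have := isProbabilityMeasure_spectralMeasure K hg
  refine tendsto_W1_of_tendsto_moments ?_ fun n => ?_
  · filter_upwards [hpos, hnpos] with p hp hq
    exact (run p.1 p.2).isProbabilityMeasure_rawMeasure hp (norm_matSqrt_normalize hp hq)
  · rw [integral_pow_spectralMeasure]
    refine (hcomp.tendsto_inner hJ (hcomp.tendsto_iterate_polar hJ n)).congr' ?_
    filter_upwards [hpos] with p hp
    rw [Run.spectralMeasure, (run p.1 p.2).integral_pow_rawMeasure hp, iterate_euclideanOp]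

end Convergence

end MpEDMD

end

theorem corollary5p5
    {Ω : Type*} [MeasurableSpace Ω] (ω : Measure Ω)
    (F : Ω → Ω) (hF : MeasurePreserving F ω ω)
    -- for every `N` a dictionary of `N` square-integrable functions, linearly independent in `L²`
    (ψ : ∀ N : ℕ, Fin N → Ω → ℂ) (hψ : ∀ N j, MemLp (ψ N j) 2 ω)
    (hind : ∀ N, LinearIndependent ℂ (fun j => (hψ N j).toLp (ψ N j)))
    -- quadrature nodes and weights
    (x : ∀ N M : ℕ, Fin M → Ω) (w : ∀ N M : ℕ, Fin M → ℝ)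
    -- any admissible output of the algorithm
    (run : ∀ N M : ℕ, MpEDMD.Run (MpEDMD.gramMatrix (ψ N) (w N M) (x N M))
      (MpEDMD.shiftMatrix F (ψ N) (w N M) (x N M)))
    -- the spaces `V_N` are asymptotically dense
    (hdense : ∀ h : Lp ℂ 2 ω, Tendsto (fun N => Metric.infDist h
      (Submodule.span ℂ (Set.range fun j => (hψ N j).toLp (ψ N j)) : Set (Lp ℂ 2 ω)))
      atTop (𝓝 0))
    -- the quadrature converges
    (hG : ∀ N j k, Tendsto (fun M => MpEDMD.gramMatrix (ψ N) (w N M) (x N M) j k) atTop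
      (𝓝 (inner ℂ ((hψ N j).toLp (ψ N j)) ((hψ N k).toLp (ψ N k)))))
    (hA : ∀ N j k, Tendsto (fun M => MpEDMD.shiftMatrix F (ψ N) (w N M) (x N M) j k) atTop
      (𝓝 (inner ℂ ((hψ N j).toLp (ψ N j)) (MpEDMD.koopman F hF ((hψ N k).toLp (ψ N k))))))
    (g : Lp ℂ 2 ω) (hg : ‖g‖ = 1) (c : ∀ N : ℕ, Fin N → ℂ)
    (hc : Tendsto (fun N => ‖g - MpEDMD.synthesis (fun j => (hψ N j).toLp (ψ N j)) (c N)‖)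
      atTop (𝓝 0)) :
    Tendsto (fun N => limsup (fun M =>
        MpEDMD.W1 (MpEDMD.spectralMeasure (MpEDMD.koopman F hF) g)
          ((run N M).spectralMeasure (c N))) atTop)
      atTop (𝓝 0) := by
  have hc' : Tendsto (fun N => MpEDMD.synthesis (fun j => (hψ N j).toLp (ψ N j)) (c N)) atTop
      (𝓝 g) := by
    rw [tendsto_iff_norm_sub_tendsto_zero]
    exact hc.congr fun _ => norm_sub_rev _ _
  have h := MpEDMD.Run.tendsto_W1 (K := MpEDMD.koopman F hF)
    (φ := fun N j => (hψ N j).toLp (ψ N j))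
    (G := fun N M => MpEDMD.gramMatrix (ψ N) (w N M) (x N M))
    (A := fun N M => MpEDMD.shiftMatrix F (ψ N) (w N M) (x N M)) run hind hdense
    (fun _ _ => MpEDMD.isHermitian_gramMatrix _ _ _) hG hA hg hc'
  exact MpEDMD.tendsto_limsup_of_tendsto_curry (f := fun p : ℕ × ℕ =>
    MpEDMD.W1 (MpEDMD.spectralMeasure (MpEDMD.koopman F hF) g)
      ((run p.1 p.2).spectralMeasure (c p.1))) h
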